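/- Let $M$ be a smooth Riemannian manifold, let $\pi:E\to M$ be a smooth real vector bundle of finite rank $r$ with a continuous fiber metric and a smooth connection $\nabla$, let $\ell\ge 0$, and let $\alpha\in\Omega^\ell(M;E)$ be a smooth $E$-valued $\ell$-form. A simplicial region $s=[v_0,\dots,v_{\ell+1}]\subset M$ is the image of a nondegenerate Euclidean $(\ell+1)$-simplex $\sigma=[w_0,\dots,w_{\ell+1}]$ under a diffeomorphism $\psi:\sigma\to s$ with $\psi(w_i)=v_i$. Its diameter is denoted $h$. Its distortion is at most $C$ if $\operatorname{diam}(\sigma)\,|d\psi_x(u)|\le C\,h\,|u|$ for all $x\in\sigma$ and all vectors $u$. An $\ell$-subcell $m$ of $s$ containing $v_0$ is the image of an $\ell$-dimensional face of $\sigma$ having $w_0$ as a vertex. The centers $c_s$ and $c_m$ are the images of the barycenters of $\sigma$ and of that face. For $a,b\in s$ let $\mathcal R_{a,b}:E_b\to E_a$ be the $\nabla$-parallel transport along the image under $\psi$ of the straight segment of $\sigma$ joining $\psi^{-1}(a)$ and $\psi^{-1}(b)$, and for a center $c$ put $$\int_m\mathcal R^{\nabla,c}\alpha:=\int_{p\in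 m}\mathcal R_{c,p}\,\alpha_p\in E_c .$$ For $x,y\in s$ let $\boldsymbol\Omega^\nabla([v_0,x,y],v_0,y):=\mathcal R_{v_0,x}\mathcal R_{x,y}-\mathcal R_{v_0,y}:E_y\to E_{v_0}$ be the discrete curvature. Let $\int_m|\alpha|$ denote the integral over the face's unit parameter simplex $\{t_i\ge0,\ \sum t_i\le1\}\subset\mathbb R^\ell$ of the norm of the density of the pulled-back form. Then for every compact $K\subset M$ and every $C$ there are constants $A$ and $h_0>0$ such that, for every simplicial region $s\subset K$ of distortion at most $C$ and diameter $h\le h_0$ and every $\ell$-subcell $m$ of $s$ containing $v_0$, all the parallel transports above exist and are unique, the integrals below exist, and $$\mathcal R_{v_0,c_m}\int_m\mathcal R^{\nabla,c_m}\alpha=\mathcal R_{v_0,c_s}\int_m\mathcal R^{\nabla,c_s}\alpha+\mathcal O(h^{\ell+2}),$$ i.e. the norm in $E_{v_0}$ of the difference $\Delta$ of the two sides is at most $A\,h^{\ell+2}$. More precisely, $\|\boldsymbol\Omega^\nabla([v_0,x,y],v_0,y)\|\le A\,h^2$ for all $x,y\in s$, $\int_m|\alpha|\le A\,h^\ell$,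 and if $\|\boldsymbol\Omega^\nabla([v_0,x,y],v_0,y)\|\le\kappa$ for all $x,y\in s$, then $\|\Delta\|\le 2\kappa\int_m|\alpha|$. Likewise in a local frame: let $f=(f_1,\dots,f_r)$ be a smooth local frame of $E$ over an open set $U$, let $R_{a,b}$ be the matrix of $\mathcal R_{a,b}$ in this frame, and let $\alpha^{\nabla,c}_p=R_{c,p}\,\alpha_p$ (with $\alpha_p$ written in the frame $f$) be the $\mathbb R^r$-valued representation of $\alpha$ in the frame field parallel-propagated from $c$. Then for every compact $K\subset U$ and every $C$ there are $A$ and $h_0>0$ such that, for all $s$ and $m$ as above with $s\subset K$, distortion at most $C$ and $h\le h_0$, the integrals exist and $$\Big\|R_{v_0,c_m}\int_m\alpha^{\nabla,c_m}-R_{v_0,c_s}\int_m\alpha^{\nabla,c_s}\Big\|\le A\,h^{\ell+2}.$$ -/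

import Mathlib

open Set MeasureTheory Bundle
open scoped Manifold ContDiff

noncomputable section

namespace PPF

section Connection

variable {n : ℕ}
  {M : Type*} [TopologicalSpace M] [ChartedSpace (EuclideanSpace ℝ (Fin n)) M]
  {F : Type*} [NormedAddCommGroup F] [NormedSpace ℝ F]
  {E : M → Type*} [TopologicalSpace (TotalSpace F E)]
  [∀ x, NormedAddCommGroup (E x)] [∀ x, InnerProductSpace ℝ (E x)]
  [FiberBundle F E]

/-- The space of (not necessarily smooth) `E`-valued differential `ℓ`-forms on `M`. -/
abbrev BundleForm (n ℓ : ℕ) {M : Type*} [TopologicalSpace M]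
    [ChartedSpace (EuclideanSpace ℝ (Fin n)) M] (E : M → Type*)
    [∀ x, NormedAddCommGroup (E x)] [∀ x, InnerProductSpace ℝ (E x)] :=
  ∀ x : M, TangentSpace (𝓡 n) x [⋀^Fin ℓ]→L[ℝ] E x

/-- An `E`-valued `ℓ`-form is smooth when its value on any `ℓ` smooth vector fields, defined on
any open set, is a smooth section of `E` there. -/
def BundleForm.IsSmooth (F : Type*) [NormedAddCommGroup F] [NormedSpace ℝ F]
    {E : M → Type*} [TopologicalSpace (TotalSpace F E)]
    [∀ x, NormedAddCommGroup (E x)] [∀ x, InnerProductSpace ℝ (E x)] [FiberBundle F E]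
    {ℓ : ℕ} [IsManifold (𝓡 n) ∞ M] (α : BundleForm n ℓ E) : Prop :=
  ∀ U : Set M, IsOpen U → ∀ X : Fin ℓ → ∀ x : M, TangentSpace (𝓡 n) x,
    (∀ i, ContMDiffOn (𝓡 n) ((𝓡 n).prod 𝓘(ℝ, EuclideanSpace ℝ (Fin n))) ∞
      (fun x ↦ TotalSpace.mk' (EuclideanSpace ℝ (Fin n)) x (X i x)) U) →
    ContMDiffOn (𝓡 n) ((𝓡 n).prod 𝓘(ℝ, F)) ∞
      (fun x ↦ TotalSpace.mk' F x (α x (fun i ↦ X i x))) U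

/-- The local connection form `ω_x(X) u` of `∇` at `x`, in the preferred local trivialization
around `x`: the coordinates at `x` of `∇_X s`, where `s` is the local section with constant
coordinates `u`. -/
def connectionForm (cov : CovariantDerivative (𝓡 n) F E) (x : M) (X : TangentSpace (𝓡 n) x)
    (u : F) : F :=
  (trivializationAt F E x
    ⟨x, cov (fun y ↦ (trivializationAt F E x).symm y u) x X⟩).2

/-- `V : [0,1] → E` is a parallel section along the curve `γ = π ∘ V`: in local coordinates it
solves `∂ₜ v + ω(γ') v = 0`. -/
def IsParallel (cov : CovariantDerivative (𝓡 n) F E) (V : ℝ → TotalSpace F E) : Prop :=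
  MDifferentiableOn 𝓘(ℝ, ℝ) (𝓡 n) (fun τ ↦ (V τ).proj) (Icc 0 1) ∧
  ∀ t ∈ Icc (0 : ℝ) 1,
    HasDerivWithinAt (fun τ ↦ (trivializationAt F E (V t).proj (V τ)).2)
      (-connectionForm cov (V t).proj
        (mfderivWithin 𝓘(ℝ, ℝ) (𝓡 n) (fun τ ↦ (V τ).proj) (Icc 0 1) t (1 : ℝ))
        (trivializationAt F E (V t).proj (V t)).2)
      (Icc 0 1) t

/-- `w' ∈ E_x` is the parallel transport of `w ∈ E_y` back along the curve `γ` from `x = γ(0)`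
to `y = γ(1)`. -/
def IsTransport (cov : CovariantDerivative (𝓡 n) F E) (γ : ℝ → M) {x y : M} (w : E y)
    (w' : E x) : Prop :=
  ∃ V : ℝ → TotalSpace F E, IsParallel cov V ∧ (∀ t ∈ Icc (0 : ℝ) 1, (V t).proj = γ t) ∧
    V 0 = ⟨x, w'⟩ ∧ V 1 = ⟨y, w⟩

open Classical in
/-- The parallel transport map `E_y → E_x` along the curve `γ` from `x = γ(0)` to `y = γ(1)`. -/
def transport (cov : CovariantDerivative (𝓡 n) F E) (γ : ℝ → M) (x y : M) (w : E y) : E x :=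
  if h : ∃ w' : E x, IsTransport cov γ w w' then h.choose else 0

end Connection

/-- A simplicial region of `M`: the diffeomorphic image of a (nondegenerate) Euclidean
`d`-simplex. -/
structure SimplicialRegion (n d : ℕ) (M : Type*) [TopologicalSpace M]
    [ChartedSpace (EuclideanSpace ℝ (Fin n)) M] where
  /-- the Euclidean simplex `σ` -/
  simplex : Affine.Simplex ℝ (EuclideanSpace ℝ (Fin d)) d
  /-- the parametrization `ψ : σ → s` -/
  param : EuclideanSpace ℝ (Fin d) → M
  smooth : ContMDiffOn (𝓡 d) (𝓡 n) ∞ param simplex.closedInterior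
  injOn : InjOn param simplex.closedInterior
  immersion : ∀ x ∈ simplex.closedInterior,
    Function.Injective (mfderivWithin (𝓡 d) (𝓡 n) param simplex.closedInterior x)

/-- The standard parameter simplex `{t ∈ ℝ^ℓ | tᵢ ≥ 0, ∑ tᵢ ≤ 1}`. -/
def unitSimplex (ℓ : ℕ) : Set (Fin ℓ → ℝ) := {t | (∀ i, 0 ≤ t i) ∧ ∑ i, t i ≤ 1}

/-- The affine parametrization of an `ℓ`-simplex `τ` by `unitSimplex ℓ`. -/
def simplexPoint {d ℓ : ℕ} (τ : Affine.Simplex ℝ (EuclideanSpace ℝ (Fin d)) ℓ)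
    (t : Fin ℓ → ℝ) : EuclideanSpace ℝ (Fin d) :=
  τ.points 0 + ∑ i, t i • (τ.points i.succ - τ.points 0)

namespace SimplicialRegion

/-- The region `s = ψ(σ)` as a subset of `M`. -/
def carrier {n d : ℕ} {M : Type*} [TopologicalSpace M]
    [ChartedSpace (EuclideanSpace ℝ (Fin n)) M] (S : SimplicialRegion n d M) : Set M :=
  S.param '' S.simplex.closedInterior

/-- The diameter `h` of the region `s`. (It is finite: `s` is compact and joined by paths of
finite length.) -/
def diam {n d : ℕ} {M : Type*} [EMetricSpace M]
    [ChartedSpace (EuclideanSpace ℝ (Fin n)) M] (S : SimplicialRegion n d M) : ℝ :=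
  (Metric.ediam S.carrier).toReal

/-- The differential of the parametrization of `s`. -/
def deriv {n d : ℕ} {M : Type*} [TopologicalSpace M]
    [ChartedSpace (EuclideanSpace ℝ (Fin n)) M] (S : SimplicialRegion n d M)
    (x u : EuclideanSpace ℝ (Fin d)) : TangentSpace (𝓡 n) (S.param x) :=
  mfderivWithin (𝓡 d) (𝓡 n) S.param S.simplex.closedInterior x u

/-- The distortion of the parametrization is at most `C`: after rescaling `σ` and `s` to unit
diameter, the differential `dψ` has norm at most `C`. -/
def DistortionLE {n d : ℕ} {M : Type*} [EMetricSpace M]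
    [ChartedSpace (EuclideanSpace ℝ (Fin n)) M]
    [RiemannianBundle (fun x : M ↦ TangentSpace (𝓡 n) x)]
    (S : SimplicialRegion n d M) (C : ℝ) : Prop :=
  ∀ x ∈ S.simplex.closedInterior, ∀ u : EuclideanSpace ℝ (Fin d),
    Metric.diam S.simplex.closedInterior * ‖S.deriv x u‖ ≤ C * S.diam * ‖u‖

section Transport

variable {n d ℓ : ℕ}
  {M : Type*} [TopologicalSpace M] [ChartedSpace (EuclideanSpace ℝ (Fin n)) M]
  {F : Type*} [NormedAddCommGroup F] [NormedSpace ℝ F]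
  {E : M → Type*} [TopologicalSpace (TotalSpace F E)]
  [∀ x, NormedAddCommGroup (E x)] [∀ x, InnerProductSpace ℝ (E x)]
  [FiberBundle F E]

/-- The image in `s` of the straight segment of `σ` from `a` to `b`, i.e. the path, traversed
from `a` to `b`, along which the radial retraction onto `a` moves `b`. -/
def path (S : SimplicialRegion n d M) (a b : EuclideanSpace ℝ (Fin d)) (t : ℝ) : M :=
  S.param (AffineMap.lineMap a b t)

/-- The parallel transport `𝓡_{a,b} : E_b → E_a` along the image in `s` of the straight segment
between `a, b ∈ σ`. As a function of `b` this is the transport field of the frame field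
parallel-propagated from `a`. -/
def R (S : SimplicialRegion n d M) (cov : CovariantDerivative (𝓡 n) F E)
    (a b : EuclideanSpace ℝ (Fin d)) : E (S.param b) → E (S.param a) :=
  transport cov (S.path a b) (S.param a) (S.param b)

/-- The density with respect to `dt₁ ⋯ dt_ℓ` of the restriction of `α` to the subcell with
parameter simplex `τ`. -/
def density (S : SimplicialRegion n d M) (α : BundleForm n ℓ E)
    (τ : Affine.Simplex ℝ (EuclideanSpace ℝ (Fin d)) ℓ) (t : Fin ℓ → ℝ) :
    E (S.param (simplexPoint τ t)) :=
  α (S.param (simplexPoint τ t))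
    (fun i ↦ S.deriv (simplexPoint τ t) (τ.points i.succ - τ.points 0))

/-- The density of the `E_c`-valued form `p ↦ 𝓡_{c,p} α_p` on the subcell with parameter
simplex `τ`. -/
def transportedDensity (S : SimplicialRegion n d M) (cov : CovariantDerivative (𝓡 n) F E)
    (α : BundleForm n ℓ E) (τ : Affine.Simplex ℝ (EuclideanSpace ℝ (Fin d)) ℓ)
    (c : EuclideanSpace ℝ (Fin d)) (t : Fin ℓ → ℝ) : E (S.param c) :=
  S.R cov c (simplexPoint τ t) (S.density α τ t)

/-- The connection-dependent integral `∫_m 𝓡^{∇,c} α ∈ E_c` over the subcell `m` with parameter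
simplex `τ`. -/
def connIntegral (S : SimplicialRegion n d M) (cov : CovariantDerivative (𝓡 n) F E)
    (α : BundleForm n ℓ E) (τ : Affine.Simplex ℝ (EuclideanSpace ℝ (Fin d)) ℓ)
    (c : EuclideanSpace ℝ (Fin d)) : E (S.param c) :=
  ∫ t in unitSimplex ℓ, S.transportedDensity cov α τ c t

/-- The total mass `∫_m |α|`. -/
def massIntegral (S : SimplicialRegion n d M) (α : BundleForm n ℓ E)
    (τ : Affine.Simplex ℝ (EuclideanSpace ℝ (Fin d)) ℓ) : ℝ :=
  ∫ t in unitSimplex ℓ, ‖S.density α τ t‖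

/-- The discrete curvature of the triangle `[a,x,y]`, with evaluation fiber at `a` and cut fiber
at `y`: `𝓡_{a,x} 𝓡_{x,y} - 𝓡_{a,y}`. -/
def discreteCurvature (S : SimplicialRegion n d M) (cov : CovariantDerivative (𝓡 n) F E)
    (a x y : EuclideanSpace ℝ (Fin d)) (w : E (S.param y)) : E (S.param a) :=
  S.R cov a x (S.R cov x y w) - S.R cov a y w

/-- The difference `𝓡_{v₀,c_m} ∫_m 𝓡^{∇,c_m} α - 𝓡_{v₀,c_s} ∫_m 𝓡^{∇,c_s} α ∈ E_{v₀}`, where `m` is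
the subcell with parameter simplex `τ`, and `c_m`, `c_s` are the images of the barycenters of `τ`
and of `σ`. -/
def centerDifference (S : SimplicialRegion n d M) (cov : CovariantDerivative (𝓡 n) F E)
    (α : BundleForm n ℓ E) (τ : Affine.Simplex ℝ (EuclideanSpace ℝ (Fin d)) ℓ) :
    E (S.param (S.simplex.points 0)) :=
  S.R cov (S.simplex.points 0) τ.centroid (S.connIntegral cov α τ τ.centroid) -
    S.R cov (S.simplex.points 0) S.simplex.centroid
      (S.connIntegral cov α τ S.simplex.centroid)

variable {r : ℕ} {f : Fin r → ∀ x : M, E x} {U : Set M}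

/-- The matrix of `𝓡_{a,b}` in the local frame `f`. -/
def frameMatrix (S : SimplicialRegion n d M) (cov : CovariantDerivative (𝓡 n) F E)
    (hf : IsLocalFrameOn (𝓡 n) F ∞ f U) (a b : EuclideanSpace ℝ (Fin d)) :
    Matrix (Fin r) (Fin r) ℝ :=
  Matrix.of fun i j ↦ hf.coeff i (S.param a) (S.R cov a b (f j (S.param b)))

/-- The density on the subcell with parameter simplex `τ` of the `ℝʳ`-valued form
`α^{∇,c} = R^{∇,c} α`, the representation of `α` in the frame field parallel-propagated from `c`. -/
def ppfDensity (S : SimplicialRegion n d M) (cov : CovariantDerivative (𝓡 n) F E)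
    (hf : IsLocalFrameOn (𝓡 n) F ∞ f U) (α : BundleForm n ℓ E)
    (τ : Affine.Simplex ℝ (EuclideanSpace ℝ (Fin d)) ℓ)
    (c : EuclideanSpace ℝ (Fin d)) (t : Fin ℓ → ℝ) : Fin r → ℝ :=
  (S.frameMatrix cov hf c (simplexPoint τ t)).mulVec
    (fun i ↦ hf.coeff i (S.param (simplexPoint τ t)) (S.density α τ t))

/-- The difference `R_{v₀,c_m} ∫_m α^{∇,c_m} - R_{v₀,c_s} ∫_m α^{∇,c_s} ∈ ℝʳ` in the local
frame `f`, where `m` is the subcell with parameter simplex `τ`. -/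
def frameCenterDifference (S : SimplicialRegion n d M) (cov : CovariantDerivative (𝓡 n) F E)
    (hf : IsLocalFrameOn (𝓡 n) F ∞ f U) (α : BundleForm n ℓ E)
    (τ : Affine.Simplex ℝ (EuclideanSpace ℝ (Fin d)) ℓ) : Fin r → ℝ :=
  (S.frameMatrix cov hf (S.simplex.points 0) τ.centroid).mulVec
      (∫ t in unitSimplex ℓ, S.ppfDensity cov hf α τ τ.centroid t) -
    (S.frameMatrix cov hf (S.simplex.points 0) S.simplex.centroid).mulVec
      (∫ t in unitSimplex ℓ, S.ppfDensity cov hf α τ S.simplex.centroid t)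

end Transport

end SimplicialRegion

end PPF

end

/-! The two integrals live in different fibers, but after transport to `v₀` both integrands can be
compared with the direct transport `𝓡_{v₀,p} α_p`. By linearity the transport to `v₀` moves inside
each integral. Subtracting `𝓡_{v₀,p} α_p` from both integrands writes `Δ` as the integral over `m`
of a difference of two discrete curvatures, those of `[v₀, c_m, p]` and `[v₀, c_s, p]`, applied to
`α_p`. Hence `‖Δ‖ ≤ 2κ ∫_m |α|` (`norm_centerDifference_le`), and the order `h^(ℓ+2)` is the product
of `κ = O(h²)` and `∫_m |α| = O(h^ℓ)`.

The curvature bound is elementary and uses neither the curvature tensor nor Stokes. In a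
trivialization and a chart the connection is `d + Γ` with `Γ` bounded and Lipschitz
(`exists_isLocalConnectionForm`), and transport along a segment solves a linear equation `v' = -Θ v`
with `Θ = Γ(γ)(γ')` (`isTransport_iff`). The distortion bound makes `Θ = O(h)`. Expanding to first
order and freezing `Γ` at one point `a` of the region, transport from `y` to `x` sends `w` to `w +
Γ_a(y - x) w + O(h²)`, with points read in the chart. The frozen linear terms of the three sides of
a triangle cancel because `(x - a) + (y - x) = y - a`, so only second-order terms remain
(`norm_isBackwardValue_triangle_le`).

The mass bound holds because `α` has locally bounded coefficients and is fed `ℓ` edge vectors whose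
images have length `O(h)` (`norm_density_le`). All constants are uniform near each point of `M`. A
finite subcover and a Lebesgue number make them uniform on `K`, since a region of small diameter
lies in a single good neighborhood (`exists_transportBounds`).

In a local frame, the matrix expression is the coordinate vector at `v₀` of the intrinsic `Δ`
(`frameCenterDifference_eq`), and frame coefficients are bounded by the fiber norm uniformly on
compact sets (`exists_coeff_le`). -/

noncomputable section

namespace PPF

open Filter Topology

/-! ### Linear equations on the unit interval, solved backward from time 1. -/

section LinearODE

variable {F : Type*} [NormedAddCommGroup F] [NormedSpace ℝ F]

/-- `w'` is the value at time `0` of the solution of `v' = -Θ v` on `[0,1]` with `v 1 = w`. -/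
def IsBackwardValue (Θ : ℝ → F →L[ℝ] F) (w w' : F) : Prop :=
  ∃ v : ℝ → F, (∀ t ∈ Icc (0 : ℝ) 1, HasDerivWithinAt v (-(Θ t (v t))) (Icc 0 1) t) ∧
    v 0 = w' ∧ v 1 = w

theorem norm_sub_le_of_hasDerivWithinAt_Icc {v v' : ℝ → F} {C : ℝ}
    (hv : ∀ t ∈ Icc (0 : ℝ) 1, HasDerivWithinAt v (v' t) (Icc 0 1) t)
    (hb : ∀ t ∈ Icc (0 : ℝ) 1, ‖v' t‖ ≤ C) {t : ℝ} (ht : t ∈ Icc (0 : ℝ) 1) :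
    ‖v t - v 1‖ ≤ C := by
  have h1 : (1 : ℝ) ∈ Icc (0 : ℝ) 1 := ⟨zero_le_one, le_rfl⟩
  have hC : 0 ≤ C := (norm_nonneg _).trans (hb 1 h1)
  have := (convex_Icc (0 : ℝ) 1).norm_image_sub_le_of_norm_hasDerivWithin_le hv hb h1 ht
  refine this.trans (mul_le_of_le_one_right hC ?_)
  rw [Real.norm_eq_abs, abs_le]
  constructor <;> linarith [ht.1, ht.2]

/-- A substitute for Grönwall when the coefficient is at most `1/2`. At a maximum point of `‖v‖` the
mean value inequality gives `‖v m‖ ≤ ‖v 1‖ + ‖v m‖ / 2 + δ`, and half of the left side is absorbed.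
-/
theorem norm_le_of_hasDerivWithinAt_Icc {v v' : ℝ → F} {δ : ℝ}
    (hv : ∀ t ∈ Icc (0 : ℝ) 1, HasDerivWithinAt v (v' t) (Icc 0 1) t)
    (hb : ∀ t ∈ Icc (0 : ℝ) 1, ‖v' t‖ ≤ 1 / 2 * ‖v t‖ + δ) {t : ℝ} (ht : t ∈ Icc (0 : ℝ) 1) :
    ‖v t‖ ≤ 2 * (‖v 1‖ + δ) := by
  have hc : ContinuousOn (fun t ↦ ‖v t‖) (Icc (0 : ℝ) 1) :=
    fun s hs ↦ (hv s hs).continuousWithinAt.norm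
  obtain ⟨m, hm, hmax⟩ := isCompact_Icc.exists_isMaxOn ⟨t, ht⟩ hc
  have hmax' : ∀ s ∈ Icc (0 : ℝ) 1, ‖v s‖ ≤ ‖v m‖ := fun s hs ↦ hmax hs
  have h := norm_sub_le_of_hasDerivWithinAt_Icc hv (C := 1 / 2 * ‖v m‖ + δ)
    (fun s hs ↦ (hb s hs).trans (by linarith [hmax' s hs])) hm
  have h2 := norm_sub_norm_le (v m) (v 1)
  linarith [hmax' t ht]

variable {Θ Θ' : ℝ → F →L[ℝ] F} {w w' z z' : F}

/-- The difference of two solutions solves the first equation with the forcing term `-(Θ - Θ') u`,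
where `‖u‖ ≤ 2 ‖z‖`. This one stability estimate yields uniqueness, the a priori bound, and later
the continuity of transport in its endpoint. -/
theorem IsBackwardValue.norm_sub_le (h : IsBackwardValue Θ w w') (h' : IsBackwardValue Θ' z z')
    (hΘ : ∀ t ∈ Icc (0 : ℝ) 1, ‖Θ t‖ ≤ 1 / 2) (hΘ' : ∀ t ∈ Icc (0 : ℝ) 1, ‖Θ' t‖ ≤ 1 / 2)
    {δ : ℝ} (hδ : ∀ t ∈ Icc (0 : ℝ) 1, ‖Θ t - Θ' t‖ ≤ δ) :
    ‖w' - z'‖ ≤ 2 * (‖w - z‖ + δ * (2 * ‖z‖)) := by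
  obtain ⟨v, hv, rfl, rfl⟩ := h
  obtain ⟨u, hu, rfl, rfl⟩ := h'
  have h0 : (0 : ℝ) ∈ Icc (0 : ℝ) 1 := ⟨le_rfl, zero_le_one⟩
  have hδ0 : 0 ≤ δ := (norm_nonneg _).trans (hδ 0 h0)
  have hub : ∀ t ∈ Icc (0 : ℝ) 1, ‖u t‖ ≤ 2 * ‖u 1‖ := fun t ht ↦ by
    simpa using norm_le_of_hasDerivWithinAt_Icc (δ := 0) hu (fun s hs ↦ by
      rw [norm_neg, add_zero]
      exact (ContinuousLinearMap.le_opNorm _ _).trans (by gcongr; exact hΘ' s hs)) ht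
  refine norm_le_of_hasDerivWithinAt_Icc (v := fun t ↦ v t - u t)
    (fun t ht ↦ (hv t ht).sub (hu t ht)) (fun t ht ↦ ?_) h0
  have e : -(Θ t (v t)) - -(Θ' t (u t)) = -(Θ t (v t - u t)) - (Θ t - Θ' t) (u t) := by
    simp only [map_sub, sub_apply]; abel
  rw [e]
  refine (norm_sub_le _ _).trans (add_le_add ?_ ?_)
  · rw [norm_neg]
    exact (ContinuousLinearMap.le_opNorm _ _).trans (by gcongr; exact hΘ t ht)
  · exact (ContinuousLinearMap.le_opNorm _ _).trans
      (mul_le_mul (hδ t ht) (hub t ht) (norm_nonneg _) hδ0)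

theorem IsBackwardValue.add (h : IsBackwardValue Θ w w') (h' : IsBackwardValue Θ z z') :
    IsBackwardValue Θ (w + z) (w' + z') := by
  obtain ⟨v, hv, rfl, rfl⟩ := h
  obtain ⟨u, hu, rfl, rfl⟩ := h'
  refine ⟨fun t ↦ v t + u t, fun t ht ↦ ((hv t ht).add (hu t ht)).congr_deriv ?_, rfl, rfl⟩
  rw [map_add]; abel

theorem IsBackwardValue.smul (c : ℝ) (h : IsBackwardValue Θ w w') :
    IsBackwardValue Θ (c • w) (c • w') := by
  obtain ⟨v, hv, rfl, rfl⟩ := h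
  refine ⟨fun t ↦ c • v t, fun t ht ↦ ((hv t ht).const_smul c).congr_deriv ?_, rfl, rfl⟩
  rw [map_smul, smul_neg]

theorem isBackwardValue_zero : IsBackwardValue Θ 0 0 :=
  ⟨fun _ ↦ 0, fun t _ ↦ by simpa using hasDerivWithinAt_const t _ (0 : F), rfl, rfl⟩

theorem IsBackwardValue.norm_le (h : IsBackwardValue Θ w w')
    (hΘ : ∀ t ∈ Icc (0 : ℝ) 1, ‖Θ t‖ ≤ 1 / 2) : ‖w'‖ ≤ 2 * ‖w‖ := by
  simpa using h.norm_sub_le isBackwardValue_zero hΘ hΘ (δ := 0) (by simp)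

theorem IsBackwardValue.unique (h : IsBackwardValue Θ w w') (h' : IsBackwardValue Θ w z')
    (hΘ : ∀ t ∈ Icc (0 : ℝ) 1, ‖Θ t‖ ≤ 1 / 2) : w' = z' := by
  have := h.norm_sub_le h' hΘ hΘ (δ := 0) (by simp)
  simpa [sub_eq_zero] using this

theorem exists_isBackwardValue [CompleteSpace F] (hc : ContinuousOn Θ (Icc 0 1))
    (hΘ : ∀ t ∈ Icc (0 : ℝ) 1, ‖Θ t‖ ≤ 1 / 2) (w : F) : ∃ w', IsBackwardValue Θ w w' := by
  -- The ball of radius `‖w‖` about `w` suffices: on it `‖x‖ ≤ 2 ‖w‖`, so the field has norm at most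
  -- `‖w‖` and a solution cannot leave within unit time.
  have hpl : IsPicardLindelof (fun t x ↦ -(Θ t x)) (⟨1, zero_le_one, le_rfl⟩ : Icc (0 : ℝ) 1) w
      ‖w‖₊ 0 ‖w‖₊ 1 := by
    refine ⟨fun t ht ↦ ?_, fun x _ ↦ (hc.clm_apply continuousOn_const).neg, fun t ht x hx ↦ ?_, ?_⟩
    · refine LipschitzOnWith.of_dist_le_mul fun x _ y _ ↦ ?_
      rw [dist_neg_neg, dist_eq_norm, dist_eq_norm, ← map_sub]
      refine (ContinuousLinearMap.le_opNorm _ _).trans ?_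
      gcongr
      exact (hΘ t ht).trans (by norm_num)
    · rw [norm_neg]
      rw [mem_closedBall_iff_norm, coe_nnnorm] at hx
      have h2 := norm_sub_norm_le x w
      have h3 : ‖x‖ ≤ 2 * ‖w‖ := by linarith
      calc ‖Θ t x‖ ≤ ‖Θ t‖ * ‖x‖ := ContinuousLinearMap.le_opNorm _ _
        _ ≤ 1 / 2 * (2 * ‖w‖) := by gcongr; exact hΘ t ht
        _ = ‖w‖₊ := by simp
    · simp
  obtain ⟨v, hv1, hv⟩ := hpl.exists_eq_forall_mem_Icc_hasDerivWithinAt₀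
  exact ⟨v 0, v, hv, rfl, hv1⟩

theorem IsBackwardValue.exists_norm_sub_le (h : IsBackwardValue Θ w w') {η : ℝ}
    (hη : η ≤ 1 / 2) (hΘ : ∀ t ∈ Icc (0 : ℝ) 1, ‖Θ t‖ ≤ η) :
    ∃ v : ℝ → F, (∀ t ∈ Icc (0 : ℝ) 1, HasDerivWithinAt v (-(Θ t (v t))) (Icc 0 1) t) ∧
      v 0 = w' ∧ v 1 = w ∧ ∀ t ∈ Icc (0 : ℝ) 1, ‖v t - w‖ ≤ 2 * η * ‖w‖ := by
  obtain ⟨v, hv, rfl, rfl⟩ := h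
  have hη0 : 0 ≤ η := (norm_nonneg _).trans (hΘ 0 ⟨le_rfl, zero_le_one⟩)
  have hvb : ∀ t ∈ Icc (0 : ℝ) 1, ‖v t‖ ≤ 2 * ‖v 1‖ := fun t ht ↦ by
    simpa using norm_le_of_hasDerivWithinAt_Icc (δ := 0) hv (fun s hs ↦ by
      rw [norm_neg, add_zero]
      exact (ContinuousLinearMap.le_opNorm _ _).trans
        (by gcongr; exact (hΘ s hs).trans hη)) ht
  refine ⟨v, hv, rfl, rfl, fun t ht ↦ norm_sub_le_of_hasDerivWithinAt_Icc hv (fun s hs ↦ ?_) ht⟩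
  rw [norm_neg, mul_comm 2 η, mul_assoc]
  exact (ContinuousLinearMap.le_opNorm _ _).trans
    (mul_le_mul (hΘ s hs) (hvb s hs) (norm_nonneg _) hη0)

theorem IsBackwardValue.norm_sub_self_le (h : IsBackwardValue Θ w w') {η : ℝ}
    (hη : η ≤ 1 / 2) (hΘ : ∀ t ∈ Icc (0 : ℝ) 1, ‖Θ t‖ ≤ η) : ‖w' - w‖ ≤ 2 * η * ‖w‖ := by
  obtain ⟨v, -, rfl, -, hv⟩ := h.exists_norm_sub_le hη hΘ
  exact hv 0 ⟨le_rfl, zero_le_one⟩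

/-- First-order expansion of the solution. The curve `v + Λ (v 1)` has derivative `-Θ (v - v 1) - (Θ
- Λ') (v 1)`. The first term is at most `2η²‖w‖` because `v` stays within `2η‖w‖` of `w`, the second
at most `ρ‖w‖`. Allowing an approximate primitive `Λ` avoids any integral of `Θ`. -/
theorem IsBackwardValue.norm_sub_primitive_le (h : IsBackwardValue Θ w w') {η ρ : ℝ}
    (hη : η ≤ 1 / 2) (hΘ : ∀ t ∈ Icc (0 : ℝ) 1, ‖Θ t‖ ≤ η) {Λ Λ' : ℝ → F →L[ℝ] F}
    (hΛ : ∀ t ∈ Icc (0 : ℝ) 1, HasDerivWithinAt Λ (Λ' t) (Icc 0 1) t)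
    (hρ : ∀ t ∈ Icc (0 : ℝ) 1, ‖Θ t - Λ' t‖ ≤ ρ) :
    ‖w' - w - (Λ 1 - Λ 0) w‖ ≤ (2 * η ^ 2 + ρ) * ‖w‖ := by
  obtain ⟨v, hv, rfl, rfl, hv1⟩ := h.exists_norm_sub_le hη hΘ
  have h0 : (0 : ℝ) ∈ Icc (0 : ℝ) 1 := ⟨le_rfl, zero_le_one⟩
  have hη0 : 0 ≤ η := (norm_nonneg _).trans (hΘ 0 h0)
  have key := norm_sub_le_of_hasDerivWithinAt_Icc (C := (2 * η ^ 2 + ρ) * ‖v 1‖)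
    (fun t ht ↦ (hv t ht).add ((hΛ t ht).clm_apply (hasDerivWithinAt_const t _ (v 1))))
    (fun t ht ↦ ?_) h0
  · convert key using 2
    simp only [Pi.add_apply, sub_apply]
    abel
  · have e : -(Θ t (v t)) + (Λ' t (v 1) + Λ t 0) = -(Θ t (v t - v 1)) - (Θ t - Λ' t) (v 1) := by
      simp only [map_sub, sub_apply, map_zero]; abel
    rw [e]
    calc _ ≤ ‖Θ t (v t - v 1)‖ + ‖(Θ t - Λ' t) (v 1)‖ := by
          rw [← norm_neg (Θ t (v t - v 1))]
          exact _root_.norm_sub_le _ _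
      _ ≤ η * (2 * η * ‖v 1‖) + ρ * ‖v 1‖ := add_le_add
          ((ContinuousLinearMap.le_opNorm _ _).trans
            (mul_le_mul (hΘ t ht) (hv1 t ht) (norm_nonneg _) hη0))
          ((ContinuousLinearMap.le_opNorm _ _).trans (by gcongr; exact hρ t ht))
      _ = _ := by ring

end LinearODE

/-! ### Euclidean simplices and their affine parametrization. -/

section Simplex

variable {d ℓ : ℕ}

/-- A simplex of full dimension is convex with nonempty interior. This makes derivatives within `σ`
unambiguous, boundary included. -/
theorem uniqueDiffOn_closedInterior (s : Affine.Simplex ℝ (EuclideanSpace ℝ (Fin d)) d) :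
    UniqueDiffOn ℝ s.closedInterior := by
  rw [← s.convexHull_eq_closedInterior]
  refine uniqueDiffOn_convex (convex_convexHull ℝ _) ?_
  rw [interior_convexHull_nonempty_iff_affineSpan_eq_top,
    s.independent.affineSpan_eq_top_iff_card_eq_finrank_add_one]
  simp

theorem convex_closedInterior (s : Affine.Simplex ℝ (EuclideanSpace ℝ (Fin d)) ℓ) :
    Convex ℝ s.closedInterior := by
  rw [← s.convexHull_eq_closedInterior]
  exact convex_convexHull ℝ _

theorem diam_closedInterior_pos (s : Affine.Simplex ℝ (EuclideanSpace ℝ (Fin d)) (ℓ + 1)) :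
    0 < Metric.diam s.closedInterior := by
  have h01 : s.points 0 ≠ s.points 1 := fun h ↦ by
    have := s.independent.injective h
    simp at this
  exact (dist_pos.2 h01).trans_le (Metric.dist_le_diam_of_mem s.isCompact_closedInterior.isBounded
    (s.point_mem_closedInterior 0) (s.point_mem_closedInterior 1))

theorem centroid_mem_closedInterior (s : Affine.Simplex ℝ (EuclideanSpace ℝ (Fin d)) ℓ) :
    s.centroid ∈ s.closedInterior := by
  rw [Affine.Simplex.centroid, Finset.centroid_def,
    Affine.Simplex.affineCombination_mem_closedInterior_iff
      (Finset.sum_centroidWeights_eq_one_of_card_eq_add_one (n := ℓ) ℝ _ (by simp))]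
  intro i
  simp only [Finset.centroidWeights_apply, Finset.card_univ, Fintype.card_fin, Nat.cast_add,
    Nat.cast_one]
  exact ⟨by positivity, inv_le_one_of_one_le₀ (by linarith [Nat.cast_nonneg (α := ℝ) ℓ])⟩

theorem simplexPoint_mem_closedInterior (s : Affine.Simplex ℝ (EuclideanSpace ℝ (Fin d)) ℓ)
    {t : Fin ℓ → ℝ} (ht : t ∈ unitSimplex ℓ) : simplexPoint s t ∈ s.closedInterior := by
  -- In barycentric coordinates vertex `0` carries the remaining weight `1 - ∑ tᵢ`.
  have e : simplexPoint s t = ∑ i : Fin (ℓ + 1),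
      (Fin.cons (1 - ∑ i, t i) t : Fin (ℓ + 1) → ℝ) i • s.points i := by
    rw [Fin.sum_univ_succ]
    simp only [simplexPoint, Fin.cons_zero, Fin.cons_succ, smul_sub, Finset.sum_sub_distrib,
      sub_smul, one_smul, Finset.sum_smul]
    abel
  rw [e]
  refine (convex_closedInterior s).sum_mem (fun i _ ↦ ?_) ?_
    (fun i _ ↦ s.point_mem_closedInterior i)
  · refine Fin.cases ?_ (fun j ↦ ?_) i
    · simpa using ht.2
    · simpa using ht.1 j
  · rw [Fin.sum_univ_succ]
    simp

theorem continuous_simplexPoint (s : Affine.Simplex ℝ (EuclideanSpace ℝ (Fin d)) ℓ) :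
    Continuous (simplexPoint s) := by
  unfold simplexPoint
  fun_prop

theorem isCompact_unitSimplex (ℓ : ℕ) : IsCompact (unitSimplex ℓ) := by
  refine (isCompact_univ_pi fun _ ↦ isCompact_Icc (a := (0 : ℝ)) (b := 1)).of_isClosed_subset ?_
    fun t ht i _ ↦ ⟨ht.1 i, (Finset.single_le_sum (fun j _ ↦ ht.1 j) (Finset.mem_univ i)).trans
      ht.2⟩
  have e : unitSimplex ℓ = (⋂ i, {t | 0 ≤ t i}) ∩ {t | ∑ i, t i ≤ 1} := by
    ext t; simp [unitSimplex]
  rw [e]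
  exact (isClosed_iInter fun i ↦ isClosed_le continuous_const (continuous_apply i)).inter
    (isClosed_le (continuous_finsetSum _ fun i _ ↦ continuous_apply i) continuous_const)

end Simplex

theorem _root_.ContDiffAt.exists_lipschitzOnWith_bounded {G H : Type*} [NormedAddCommGroup G]
    [NormedSpace ℝ G] [NormedAddCommGroup H] [NormedSpace ℝ H] {f : G → H} {z : G}
    (hf : ContDiffAt ℝ 1 f z) :
    ∃ t ∈ 𝓝 z, (∃ L, LipschitzOnWith L f t) ∧ ∃ B, ∀ y ∈ t, ‖f y‖ ≤ B := by
  obtain ⟨L, t, ht, hL⟩ := hf.exists_lipschitzOnWith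
  have hB : ∀ᶠ y in 𝓝 z, ‖f y‖ < ‖f z‖ + 1 :=
    hf.continuousAt.norm.eventually_lt_const (by linarith)
  exact ⟨_, inter_mem ht hB, ⟨L, hL.mono inter_subset_left⟩, _, fun y hy ↦ le_of_lt hy.2⟩

theorem trivialization_snd_eq {B F : Type*} [TopologicalSpace B] [NormedAddCommGroup F]
    [NormedSpace ℝ F] {E : B → Type*} [TopologicalSpace (TotalSpace F E)]
    [∀ x, AddCommMonoid (E x)] [∀ x, Module ℝ (E x)] [∀ x, TopologicalSpace (E x)]
    [FiberBundle F E] (e : Trivialization F (TotalSpace.proj : TotalSpace F E → B)) [e.IsLinear ℝ]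
    {y : B} (hy : y ∈ e.baseSet) (w : E y) : (e ⟨y, w⟩).2 = e.continuousLinearMapAt ℝ y w := by
  rw [e.continuousLinearMapAt_apply ℝ, e.coe_linearMapAt_of_mem hy]

/-! ### The connection as `d + Γ` in a trivialization and a chart. -/

section LocalConnection

variable {n : ℕ}
  {M : Type*} [TopologicalSpace M] [ChartedSpace (EuclideanSpace ℝ (Fin n)) M]
  {F : Type*} [NormedAddCommGroup F] [NormedSpace ℝ F]
  {E : M → Type*} [TopologicalSpace (TotalSpace F E)]
  [∀ x, NormedAddCommGroup (E x)] [∀ x, InnerProductSpace ℝ (E x)]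
  [FiberBundle F E]

theorem cov_sum [VectorBundle ℝ F E] (cov : CovariantDerivative (𝓡 n) F E) {ι : Type*} (t : Finset ι)
    (σ : ι → ∀ x : M, E x) {y : M}
    (hσ : ∀ i ∈ t, MDifferentiableAt (𝓡 n) ((𝓡 n).prod 𝓘(ℝ, F))
      (fun x ↦ TotalSpace.mk' F x (σ i x)) y) :
    cov (fun x ↦ ∑ i ∈ t, σ i x) y = ∑ i ∈ t, cov (σ i) y := by
  classical
  induction t using Finset.induction_on with
  | empty =>
    simp only [Finset.sum_empty]
    exact congrFun cov.zero y
  | insert a t ha ih =>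
    have e : (fun x ↦ ∑ i ∈ insert a t, σ i x) = σ a + fun x ↦ ∑ i ∈ t, σ i x := by
      ext x; simp [Finset.sum_insert ha]
    rw [e, cov.isCovariantDerivativeOnUniv.add (hσ a (by simp)), Finset.sum_insert ha,
      ih fun i hi ↦ hσ i (by simp [hi])]
    exact MDifferentiableAt.sum_section fun i hi ↦ hσ i (by simp [hi])

variable [IsManifold (𝓡 n) ∞ M] [T2Space M]
  [VectorBundle ℝ F E] [ContMDiffVectorBundle ∞ F E (𝓡 n)]

/-- A bump function extends the sections with constant coordinates by zero to smooth global
sections, on which the smoothness of the connection can be tested. Agreement is needed near each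
point of `W`, since a covariant derivative depends on the germ of the section, and `W` must not
depend on `u`. -/
theorem exists_contMDiff_section_eventuallyEq_symm (x₀ : M) :
    ∃ W ∈ 𝓝 x₀, W ⊆ (trivializationAt F E x₀).baseSet ∧
      ∀ u : F, ∃ σ : ∀ x, E x, ContMDiff (𝓡 n) ((𝓡 n).prod 𝓘(ℝ, F)) ∞
        (fun x ↦ TotalSpace.mk' F x (σ x)) ∧
      ∀ y ∈ W, ∀ᶠ z in 𝓝 y, σ z = (trivializationAt F E x₀).symm z u := by
  set e := trivializationAt F E x₀ with he
  have hx₀ : e.baseSet ∈ 𝓝 x₀ := e.open_baseSet.mem_nhds (mem_baseSet_trivializationAt F E x₀)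
  obtain ⟨f, -, hf⟩ := ((SmoothBumpFunction.nhds_basis_tsupport (I := 𝓡 n) x₀).mem_iff).1 hx₀
  have hW : ∀ᶠ y in 𝓝 x₀, ∀ᶠ z in 𝓝 y, f z = 1 :=
    eventually_eventually_nhds.2 f.eventuallyEq_one
  refine ⟨_, inter_mem hW hx₀, inter_subset_right, fun u ↦
    ⟨(f : M → ℝ) • fun x ↦ e.symm x u, fun x ↦ ?_, fun y hy ↦ ?_⟩⟩
  · by_cases hx : x ∈ e.baseSet
    · refine (f.contMDiff x).smul_section ?_
      rw [e.contMDiffAt_section_iff hx]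
      refine (contMDiffAt_const (c := u)).congr_of_eventuallyEq ?_
      filter_upwards [e.open_baseSet.mem_nhds hx] with z hz
      simp [e.apply_mk_symm hz]
    · have hz : ∀ᶠ z in 𝓝 x, f z = 0 := by
        have := notMem_tsupport_iff_eventuallyEq.1 (fun h ↦ hx (hf h))
        exact this
      refine (contMDiffAt_zeroSection (IB := 𝓡 n) ℝ E).congr_of_eventuallyEq ?_
      filter_upwards [hz] with z hz
      simp [hz, zeroSection]
  · filter_upwards [hy.1] with z hz
    simp [hz]

/-- On `W`, in the trivialization of `E` and the chart of `M` at `x₀`, the connection `cov` is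
`d + Γ`. -/
structure IsLocalConnectionForm (cov : CovariantDerivative (𝓡 n) F E) (x₀ : M)
    (Γ : EuclideanSpace ℝ (Fin n) → EuclideanSpace ℝ (Fin n) →L[ℝ] F →L[ℝ] F) (W : Set M) :
    Prop where
  subset_baseSet : W ⊆ (trivializationAt F E x₀).baseSet
  subset_source : W ⊆ (chartAt (EuclideanSpace ℝ (Fin n)) x₀).source
  cov_eq : ∀ y ∈ W, ∀ s : ∀ x, E x, MDifferentiableAt (𝓡 n) ((𝓡 n).prod 𝓘(ℝ, F))
    (fun x ↦ TotalSpace.mk' F x (s x)) y → ∀ X : TangentSpace (𝓡 n) y,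
    (trivializationAt F E x₀ ⟨y, cov s y X⟩).2 =
      mvfderiv (𝓡 n) (fun z ↦ (trivializationAt F E x₀ ⟨z, s z⟩).2) y X +
      Γ (extChartAt (𝓡 n) x₀ y) ((trivializationAt (EuclideanSpace ℝ (Fin n))
        (TangentSpace (𝓡 n) : M → Type _) x₀).continuousLinearMapAt ℝ y X)
        (trivializationAt F E x₀ ⟨y, s y⟩).2

set_option maxHeartbeats 1000000 in
/-- In a trivialization near `x₀`, a smooth connection is `d + Γ` with `Γ` a bounded Lipschitz
function of the chart coordinates. -/
theorem exists_isLocalConnectionForm [FiniteDimensional ℝ F] (cov : CovariantDerivative (𝓡 n) F E)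
    (hcov : cov.ContMDiffCovariantDerivative ∞) (x₀ : M) :
    ∃ Γ, ∃ W ∈ 𝓝 x₀, IsLocalConnectionForm cov x₀ Γ W ∧
      (∃ L, LipschitzOnWith L Γ (extChartAt (𝓡 n) x₀ '' W)) ∧
      (∃ B, ∀ y ∈ W, ‖Γ (extChartAt (𝓡 n) x₀ y)‖ ≤ B) := by
  obtain ⟨W₁, hW₁, hW₁e, hσ⟩ := exists_contMDiff_section_eventuallyEq_symm (n := n) (F := F) (E := E) x₀
  choose σ hσs hσW using hσ
  set e := trivializationAt F E x₀ with he
  set eT := trivializationAt (EuclideanSpace ℝ (Fin n)) (TangentSpace (𝓡 n) : M → Type _) x₀ with heT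
  let b := Module.finBasis ℝ F
  -- The coordinates of `∇ σ(bᵢ)`, a smooth section of the bundle of homomorphisms from `TM` to `E`.
  let a : Fin (Module.finrank ℝ F) → M → EuclideanSpace ℝ (Fin n) →L[ℝ] F := fun i y ↦
    ContinuousLinearMap.inCoordinates (EuclideanSpace ℝ (Fin n)) (TangentSpace (𝓡 n) : M → Type _)
      F E x₀ y x₀ y (cov (σ (b i)) y)
  have ha : ∀ i, ContMDiffAt (𝓡 n) 𝓘(ℝ, EuclideanSpace ℝ (Fin n) →L[ℝ] F) ∞ (a i) x₀ := fun i ↦ by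
    have h := hcov.contMDiff.contMDiff (σ := σ (b i)) ((hσs (b i)).contMDiffOn)
    have h2 := (h.contMDiffAt univ_mem : ContMDiffAt _ _ _ _ x₀)
    rw [contMDiffAt_hom_bundle] at h2
    exact h2.2
  -- `Γ(X) u = ∑ bⁱ(u) aᵢ(X)`: since `σ(bᵢ)` has constant coordinates, its covariant derivative
  -- consists of the zeroth-order term alone.
  let Γ : EuclideanSpace ℝ (Fin n) → EuclideanSpace ℝ (Fin n) →L[ℝ] F →L[ℝ] F := fun z ↦
    ∑ i, (ContinuousLinearMap.smulRightL ℝ F F (LinearMap.toContinuousLinearMap (b.coord i))) ∘L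
      (a i ((extChartAt (𝓡 n) x₀).symm z))
  have hΓ : ContDiffAt ℝ 1 Γ (extChartAt (𝓡 n) x₀ x₀) := by
    refine ContDiffAt.sum fun i _ ↦ ContDiffAt.clm_comp contDiffAt_const ?_
    have := (contMDiffAt_iff.1 (ha i)).2
    simp only [extChartAt_model_space_eq_id, PartialEquiv.refl_coe, modelWithCornersSelf_coe,
      range_id, contDiffWithinAt_univ] at this
    exact this.of_le (by norm_num)
  obtain ⟨t, ht, ⟨L, hL⟩, B, hB⟩ := hΓ.exists_lipschitzOnWith_bounded
  have hφ : ContinuousAt (extChartAt (𝓡 n) x₀) x₀ := continuousAt_extChartAt x₀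
  refine ⟨Γ, _, inter_mem (inter_mem hW₁ (chart_source_mem_nhds _ x₀)) (hφ ht),
    ⟨fun y hy ↦ hW₁e hy.1.1, fun y hy ↦ hy.1.2, fun y hy s hs X ↦ ?_⟩, ⟨L, hL.mono ?_⟩,
    ⟨B, fun y hy ↦ hB _ hy.2⟩⟩
  swap
  · rintro _ ⟨y, hy, rfl⟩
    exact hy.2
  have hye : y ∈ e.baseSet := hW₁e hy.1.1
  have hyT : y ∈ eT.baseSet := hy.1.2
  have hsym : (extChartAt (𝓡 n) x₀).symm (extChartAt (𝓡 n) x₀ y) = y :=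
    (extChartAt (𝓡 n) x₀).left_inv (by rw [extChartAt_source]; exact hy.1.2)
  have hσd : ∀ u, MDifferentiableAt (𝓡 n) ((𝓡 n).prod 𝓘(ℝ, F))
      (fun x ↦ TotalSpace.mk' F x (σ u x)) y := fun u ↦ (hσs u y).mdifferentiableAt (by simp)
  have hse : MDifferentiableAt (𝓡 n) 𝓘(ℝ, F) (fun z ↦ (e ⟨z, s z⟩).2) y :=
    (e.mdifferentiableAt_section_iff (𝓡 n) s hye).1 hs
  let cL : Fin (Module.finrank ℝ F) → F →L[ℝ] ℝ := fun i ↦ LinearMap.toContinuousLinearMap (b.coord i)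
  let c : Fin (Module.finrank ℝ F) → M → ℝ := fun i z ↦ cL i (e ⟨z, s z⟩).2
  have hc : ∀ i, HasMFDerivAt (𝓡 n) 𝓘(ℝ, ℝ) (c i) y
      ((cL i) ∘L (mfderiv (𝓡 n) 𝓘(ℝ, F) (fun z ↦ (e ⟨z, s z⟩).2) y)) := fun i ↦
    ((cL i).hasMFDerivAt).comp y hse.hasMFDerivAt
  have hterm : ∀ i, MDifferentiableAt (𝓡 n) ((𝓡 n).prod 𝓘(ℝ, F))
      (fun x ↦ TotalSpace.mk' F x ((c i • σ (b i)) x)) y := fun i ↦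
    (hc i).mdifferentiableAt.smul_section (hσd _)
  -- Near `y` the section is a combination of the `σ(bᵢ)` with coefficients its own coordinates, so
  -- locality and the Leibniz rule split `∇s` into the differential of the coordinates and the `Γ`
  -- term.
  have hev : ∀ᶠ z in 𝓝 y, s z = ∑ i, (c i • σ (b i)) z := by
    filter_upwards [e.open_baseSet.mem_nhds hye, eventually_all.2 fun i ↦ hσW (b i) y hy.1.1]
      with z hz hσz
    have h1 : s z = e.symmL ℝ z (e ⟨z, s z⟩).2 := by
      rw [e.symmL_apply hz]; exact (e.symm_apply_apply_mk hz (s z)).symm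
    rw [h1, ← b.sum_repr (e ⟨z, s z⟩).2, map_sum]
    refine Finset.sum_congr rfl fun i _ ↦ ?_
    rw [map_smul, e.symmL_apply hz, ← hσz i]
    simp [c, cL]
  have hcs : cov s y = ∑ i, (c i y • cov (σ (b i)) y + (mvfderiv (𝓡 n) (c i) y).smulRight (σ (b i) y)) := by
    rw [cov.isCovariantDerivativeOnUniv.congr_of_eventuallyEq hs
      (MDifferentiableAt.sum_section fun i _ ↦ hterm i) univ_mem hev, cov_sum cov _ _ fun i _ ↦ hterm i]
    refine Finset.sum_congr rfl fun i _ ↦ ?_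
    rw [cov.isCovariantDerivativeOnUniv.leibniz (hσd _) (hc i).mdifferentiableAt]
  have hL : ∀ w : E y, (e ⟨y, w⟩).2 = e.continuousLinearMapAt ℝ y w := trivialization_snd_eq e hye
  have hσy : ∀ i, e.continuousLinearMapAt ℝ y (σ (b i) y) = b i := fun i ↦ by
    rw [(hσW (b i) y hy.1.1).self_of_nhds, ← hL, e.apply_mk_symm hye]
  rw [hL, hcs]
  simp only [sum_apply, add_apply,
    smul_apply, ContinuousLinearMap.smulRight_apply, map_sum, map_add, map_smul,
    hσy, Finset.sum_add_distrib]
  rw [add_comm]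
  congr 1
  · rw [← b.sum_repr (mvfderiv (𝓡 n) (fun z ↦ (e ⟨z, s z⟩).2) y X)]
    refine Finset.sum_congr rfl fun i _ ↦ ?_
    congr 1
    simp only [mvfderiv, (hc i).mfderiv]
    rfl
  · simp only [Γ, sum_apply, ContinuousLinearMap.comp_apply, hsym]
    refine Finset.sum_congr rfl fun i _ ↦ ?_
    simp only [a, ContinuousLinearMap.inCoordinates, ContinuousLinearMap.comp_apply]
    rw [Trivialization.symmL_continuousLinearMapAt _ hyT]
    rfl

end LocalConnection

theorem hasDerivWithinAt_of_hasMFDerivWithinAt {H : Type*} [NormedAddCommGroup H]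
    [NormedSpace ℝ H] {f : ℝ → H} {s : Set ℝ} {t : ℝ} {f' : ℝ →L[ℝ] H}
    (h : HasMFDerivWithinAt 𝓘(ℝ, ℝ) 𝓘(ℝ, H) f s t f') : HasDerivWithinAt f (f' 1) s t :=
  HasFDerivWithinAt.hasDerivWithinAt (hasMFDerivWithinAt_iff_hasFDerivWithinAt.1 h)

/-! ### Invariance of the parallel transport equation under change of trivialization. -/

section Parallel

variable {n : ℕ}
  {M : Type*} [TopologicalSpace M] [ChartedSpace (EuclideanSpace ℝ (Fin n)) M]
  {F : Type*} [NormedAddCommGroup F] [NormedSpace ℝ F]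
  {E : M → Type*} [TopologicalSpace (TotalSpace F E)]
  [∀ x, NormedAddCommGroup (E x)] [∀ x, InnerProductSpace ℝ (E x)]
  [FiberBundle F E] [VectorBundle ℝ F E] [ContMDiffVectorBundle ∞ F E (𝓡 n)]
  [IsManifold (𝓡 n) ∞ M]
  {cov : CovariantDerivative (𝓡 n) F E} {x₀ : M}
  {Γ : EuclideanSpace ℝ (Fin n) → EuclideanSpace ℝ (Fin n) →L[ℝ] F →L[ℝ] F} {W : Set M}

/-- The gauge transformation law `g ω = dg + Γ g`. It is needed because `connectionForm` uses the
preferred trivialization at the moving point `y`, whereas `Γ` belongs to the fixed one at `x₀`. It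
comes from applying `cov_eq` to the section constant in the trivialization at `y`, whose coordinates
at `x₀` are `g(z) u`. -/
theorem IsLocalConnectionForm.coordChangeL_connectionForm (h : IsLocalConnectionForm cov x₀ Γ W)
    {y : M} (hy : y ∈ W) (X : TangentSpace (𝓡 n) y) (u : F)
    {g' : TangentSpace (𝓡 n) y →L[ℝ] (F →L[ℝ] F)}
    (hg : HasMFDerivAt (𝓡 n) 𝓘(ℝ, F →L[ℝ] F) (fun z ↦ ((trivializationAt F E y).coordChangeL ℝ
      (trivializationAt F E x₀) z : F →L[ℝ] F)) y g') :
    (trivializationAt F E y).coordChangeL ℝ (trivializationAt F E x₀) y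
      (connectionForm cov y X u) = g' X u +
      Γ (extChartAt (𝓡 n) x₀ y) ((trivializationAt (EuclideanSpace ℝ (Fin n))
        (TangentSpace (𝓡 n) : M → Type _) x₀).continuousLinearMapAt ℝ y X)
        ((trivializationAt F E y).coordChangeL ℝ (trivializationAt F E x₀) y u) := by
  set e := trivializationAt F E x₀
  set e' := trivializationAt F E y with he'
  have hye : y ∈ e.baseSet := h.subset_baseSet hy
  have hye' : y ∈ e'.baseSet := mem_baseSet_trivializationAt F E y
  have hs : MDifferentiableAt (𝓡 n) ((𝓡 n).prod 𝓘(ℝ, F))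
      (fun x ↦ TotalSpace.mk' F x (e'.symm x u)) y := by
    refine (e'.mdifferentiableAt_section_iff (𝓡 n) (fun x ↦ e'.symm x u) hye').2 ?_
    refine (mdifferentiableAt_const (c := u)).congr_of_eventuallyEq ?_
    filter_upwards [e'.open_baseSet.mem_nhds hye'] with z hz
    simp [e'.apply_mk_symm hz]
  have hc := h.cov_eq y hy (fun x ↦ e'.symm x u) hs X
  have h1 : ∀ w : E y, e'.coordChangeL ℝ e y (e' ⟨y, w⟩).2 = (e ⟨y, w⟩).2 := fun w ↦ by
    rw [e'.coordChangeL_apply e ⟨hye', hye⟩, e'.symm_apply_apply_mk hye']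
  have h2 : (e ⟨y, e'.symm y u⟩).2 = e'.coordChangeL ℝ e y u :=
    (e'.coordChangeL_apply e ⟨hye', hye⟩ u).symm
  have h3 : mvfderiv (𝓡 n) (fun z ↦ (e ⟨z, e'.symm z u⟩).2) y X = g' X u := by
    have hu : HasMFDerivAt (𝓡 n) 𝓘(ℝ, F) (fun z ↦ (e'.coordChangeL ℝ e z : F →L[ℝ] F) u) y
        ((ContinuousLinearMap.apply ℝ F u) ∘L g') :=
      ((ContinuousLinearMap.apply ℝ F u).hasMFDerivAt).comp y hg
    have hu' := hu.congr_of_eventuallyEq (f₁ := fun z ↦ (e ⟨z, e'.symm z u⟩).2) (by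
      filter_upwards [(e'.open_baseSet.inter e.open_baseSet).mem_nhds ⟨hye', hye⟩] with z hz
      exact (e'.coordChangeL_apply e hz u).symm)
    rw [mvfderiv, hu'.mfderiv]
    rfl
  rw [h3, h2] at hc
  rw [← hc]
  exact h1 _

/-- The two coordinate curves are related by `g` evaluated along the curve. The product rule
produces `dg`, which cancels the `dg` of the gauge law, so the equation keeps its form. -/
theorem IsLocalConnectionForm.hasDerivWithinAt_iff (h : IsLocalConnectionForm cov x₀ Γ W)
    {V : ℝ → TotalSpace F E} {t : ℝ} (ht : t ∈ Icc (0 : ℝ) 1) (hVt : (V t).proj ∈ W)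
    (hV : MDifferentiableWithinAt 𝓘(ℝ, ℝ) (𝓡 n) (fun τ ↦ (V τ).proj) (Icc 0 1) t) :
    HasDerivWithinAt (fun τ ↦ (trivializationAt F E (V t).proj (V τ)).2)
      (-connectionForm cov (V t).proj
        (mfderivWithin 𝓘(ℝ, ℝ) (𝓡 n) (fun τ ↦ (V τ).proj) (Icc 0 1) t (1 : ℝ))
        (trivializationAt F E (V t).proj (V t)).2) (Icc 0 1) t ↔
    HasDerivWithinAt (fun τ ↦ (trivializationAt F E x₀ (V τ)).2)
      (-(Γ (extChartAt (𝓡 n) x₀ (V t).proj) ((trivializationAt (EuclideanSpace ℝ (Fin n))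
        (TangentSpace (𝓡 n) : M → Type _) x₀).continuousLinearMapAt ℝ (V t).proj
        (mfderivWithin 𝓘(ℝ, ℝ) (𝓡 n) (fun τ ↦ (V τ).proj) (Icc 0 1) t (1 : ℝ)))
        (trivializationAt F E x₀ (V t)).2)) (Icc 0 1) t := by
  set y := (V t).proj with hy
  set e := trivializationAt F E x₀ with he
  set e' := trivializationAt F E y with he'
  have hye : y ∈ e.baseSet := h.subset_baseSet hVt
  have hye' : y ∈ e'.baseSet := mem_baseSet_trivializationAt F E y
  have hmem : ∀ᶠ τ in 𝓝[Icc 0 1] t, (V τ).proj ∈ e'.baseSet ∩ e.baseSet :=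
    hV.continuousWithinAt.eventually ((e'.open_baseSet.inter e.open_baseSet).mem_nhds ⟨hye', hye⟩)
  have hcomp : ∀ e₁ e₂ : Trivialization F (TotalSpace.proj : TotalSpace F E → M),
      ∀ [MemTrivializationAtlas e₁] [MemTrivializationAtlas e₂],
      y ∈ e₁.baseSet → y ∈ e₂.baseSet → ∃ g' : TangentSpace (𝓡 n) y →L[ℝ] (F →L[ℝ] F),
      HasMFDerivAt (𝓡 n) 𝓘(ℝ, F →L[ℝ] F) (fun z ↦ (e₁.coordChangeL ℝ e₂ z : F →L[ℝ] F)) y g' ∧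
      HasDerivWithinAt (fun τ ↦ (e₁.coordChangeL ℝ e₂ (V τ).proj : F →L[ℝ] F))
        (g' (mfderivWithin 𝓘(ℝ, ℝ) (𝓡 n) (fun τ ↦ (V τ).proj) (Icc 0 1) t (1 : ℝ)))
        (Icc 0 1) t := fun e₁ e₂ _ _ h₁ h₂ ↦ by
    have hd : MDifferentiableAt (𝓡 n) 𝓘(ℝ, F →L[ℝ] F)
        (fun z ↦ (e₁.coordChangeL ℝ e₂ z : F →L[ℝ] F)) y :=
      (contMDiffAt_coordChangeL (n := ∞) h₁ h₂).mdifferentiableAt (by simp)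
    refine ⟨_, hd.hasMFDerivAt, ?_⟩
    have := hd.hasMFDerivAt.comp_hasMFDerivWithinAt t hV.hasMFDerivWithinAt
    exact hasDerivWithinAt_of_hasMFDerivWithinAt this
  have hchange : ∀ e₁ e₂ : Trivialization F (TotalSpace.proj : TotalSpace F E → M),
      ∀ [MemTrivializationAtlas e₁] [MemTrivializationAtlas e₂],
      (∀ᶠ τ in 𝓝[Icc 0 1] t, (V τ).proj ∈ e₁.baseSet ∩ e₂.baseSet) →
      (fun τ ↦ (e₂ (V τ)).2) =ᶠ[𝓝[Icc 0 1] t]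
        fun τ ↦ (e₁.coordChangeL ℝ e₂ (V τ).proj : F →L[ℝ] F) (e₁ (V τ)).2 :=
      fun e₁ e₂ _ _ hm ↦ by
    filter_upwards [hm] with τ hτ
    change _ = e₁.coordChangeL ℝ e₂ (V τ).proj (e₁ (V τ)).2
    rw [e₁.coordChangeL_apply e₂ hτ]
    congr 2
    exact congrArg (TotalSpace.mk' F (V τ).proj) (e₁.symm_apply_apply_mk hτ.1 (V τ).2).symm
  obtain ⟨g', hg, hgd⟩ := hcomp e' e hye' hye
  obtain ⟨k', -, hkd⟩ := hcomp e e' hye hye'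
  have hconn := h.coordChangeL_connectionForm hVt
    (mfderivWithin 𝓘(ℝ, ℝ) (𝓡 n) (fun τ ↦ (V τ).proj) (Icc 0 1) t (1 : ℝ)) (e' (V t)).2 hg
  have hval : (e (V t)).2 = e'.coordChangeL ℝ e y (e' (V t)).2 :=
    (hchange e' e hmem).self_of_nhdsWithin ht
  have hforward : ∀ w, HasDerivWithinAt (fun τ ↦ (e' (V τ)).2) w (Icc 0 1) t →
      HasDerivWithinAt (fun τ ↦ (e (V τ)).2)
        (g' (mfderivWithin 𝓘(ℝ, ℝ) (𝓡 n) (fun τ ↦ (V τ).proj) (Icc 0 1) t (1 : ℝ)) (e' (V t)).2 +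
          e'.coordChangeL ℝ e y w) (Icc 0 1) t := fun w hw ↦
    (hgd.clm_apply hw).congr_of_eventuallyEq_of_mem (hchange e' e hmem) ht
  change e'.coordChangeL ℝ e y _ = _ + (Γ (extChartAt (𝓡 n) x₀ y) _)
    (e'.coordChangeL ℝ e y (e' (V t)).2) at hconn
  rw [hval]
  constructor
  · intro hd
    refine (hforward _ hd).congr_deriv ?_
    rw [map_neg, hconn]
    abel
  · intro hd
    have hd' := (hkd.clm_apply hd).congr_of_eventuallyEq_of_mem
      (hchange e e' (hmem.mono fun _ h ↦ h.symm)) ht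
    -- Only the existence of a derivative in the other trivialization matters here. Its value is
    -- recovered by pushing it forward again, using uniqueness of derivatives on `[0,1]` and
    -- injectivity of the coordinate change.
    generalize k' _ (e (V t)).2 + _ = w at hd'
    have huniq := (uniqueDiffOn_Icc zero_lt_one t ht).eq_deriv _ (hforward _ hd') hd
    refine hd'.congr_deriv ?_
    apply (e'.coordChangeL ℝ e y).injective
    rw [map_neg, hconn]
    refine (eq_sub_of_add_eq' huniq).trans ?_
    abel

theorem IsLocalConnectionForm.isParallel_iff (h : IsLocalConnectionForm cov x₀ Γ W)
    {V : ℝ → TotalSpace F E} (hVW : ∀ t ∈ Icc (0 : ℝ) 1, (V t).proj ∈ W) :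
    IsParallel cov V ↔
      MDifferentiableOn 𝓘(ℝ, ℝ) (𝓡 n) (fun τ ↦ (V τ).proj) (Icc 0 1) ∧
      ∀ t ∈ Icc (0 : ℝ) 1, HasDerivWithinAt (fun τ ↦ (trivializationAt F E x₀ (V τ)).2)
        (-(Γ (extChartAt (𝓡 n) x₀ (V t).proj) ((trivializationAt (EuclideanSpace ℝ (Fin n))
          (TangentSpace (𝓡 n) : M → Type _) x₀).continuousLinearMapAt ℝ (V t).proj
          (mfderivWithin 𝓘(ℝ, ℝ) (𝓡 n) (fun τ ↦ (V τ).proj) (Icc 0 1) t (1 : ℝ)))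
          (trivializationAt F E x₀ (V t)).2)) (Icc 0 1) t :=
  and_congr_right fun hV ↦ forall₂_congr fun t ht ↦ h.hasDerivWithinAt_iff ht (hVW t ht) (hV t ht)

theorem hasDerivWithinAt_extChartAt_comp {γ : ℝ → M} {t : ℝ} {s : Set ℝ}
    (hγ : MDifferentiableWithinAt 𝓘(ℝ, ℝ) (𝓡 n) γ s t)
    (ht : γ t ∈ (chartAt (EuclideanSpace ℝ (Fin n)) x₀).source) :
    HasDerivWithinAt (fun τ ↦ extChartAt (𝓡 n) x₀ (γ τ))
      ((trivializationAt (EuclideanSpace ℝ (Fin n))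
        (TangentSpace (𝓡 n) : M → Type _) x₀).continuousLinearMapAt ℝ (γ t)
        (mfderivWithin 𝓘(ℝ, ℝ) (𝓡 n) γ s t (1 : ℝ))) s t := by
  have : IsManifold (𝓡 n) 1 M := .of_le (n := ∞) (by norm_num)
  rw [TangentBundle.continuousLinearMapAt_trivializationAt ht]
  have := (mdifferentiableAt_extChartAt (I := 𝓡 n) ht).hasMFDerivAt.comp_hasMFDerivWithinAt t
    hγ.hasMFDerivWithinAt
  exact hasDerivWithinAt_of_hasMFDerivWithinAt this

end Parallel

theorem totalSpace_eq_of_trivialization {B F : Type*} [TopologicalSpace B] [TopologicalSpace F]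
    {E : B → Type*} [TopologicalSpace (TotalSpace F E)]
    (e : Trivialization F (TotalSpace.proj : TotalSpace F E → B)) {z z' : TotalSpace F E}
    (hz : z.proj ∈ e.baseSet) (h : z.proj = z'.proj) (h2 : (e z).2 = (e z').2) : z = z' := by
  have hs : z ∈ e.source := e.mem_source.2 hz
  have hs' : z' ∈ e.source := e.mem_source.2 (h ▸ hz)
  refine e.injOn hs hs' (Prod.ext ?_ h2)
  exact (e.coe_fst hs).trans (h.trans (e.coe_fst hs').symm)

namespace SimplicialRegion

/-! ### Regions read in a chart, and transport as a linear equation in the model fiber. -/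

section Chart

variable {n d : ℕ} {M : Type*} [TopologicalSpace M] [ChartedSpace (EuclideanSpace ℝ (Fin n)) M]

/-- The parametrization of a region, read in the chart at `x₀`. -/
def chartMap (S : SimplicialRegion n d M) (x₀ : M) (x : EuclideanSpace ℝ (Fin d)) :
    EuclideanSpace ℝ (Fin n) :=
  extChartAt (𝓡 n) x₀ (S.param x)

/-- The differential of `SimplicialRegion.chartMap`. -/
def chartDeriv (S : SimplicialRegion n d M) (x₀ : M) (x : EuclideanSpace ℝ (Fin d)) :
    EuclideanSpace ℝ (Fin d) →L[ℝ] EuclideanSpace ℝ (Fin n) :=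
  fderivWithin ℝ (S.chartMap x₀) S.simplex.closedInterior x

variable (S : SimplicialRegion n d M) {x₀ : M}

theorem param_mem_carrier {x : EuclideanSpace ℝ (Fin d)} (hx : x ∈ S.simplex.closedInterior) :
    S.param x ∈ S.carrier := mem_image_of_mem _ hx

theorem lineMap_mem {a b : EuclideanSpace ℝ (Fin d)} (ha : a ∈ S.simplex.closedInterior)
    (hb : b ∈ S.simplex.closedInterior) {t : ℝ} (ht : t ∈ Icc (0 : ℝ) 1) :
    AffineMap.lineMap a b t ∈ S.simplex.closedInterior :=
  (convex_closedInterior S.simplex).lineMap_mem ha hb ht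

theorem mdifferentiableOn_path {a b : EuclideanSpace ℝ (Fin d)}
    (ha : a ∈ S.simplex.closedInterior) (hb : b ∈ S.simplex.closedInterior) :
    MDifferentiableOn 𝓘(ℝ, ℝ) (𝓡 n) (S.path a b) (Icc 0 1) := by
  have h : MDifferentiableOn 𝓘(ℝ, ℝ) (𝓡 d) (fun t : ℝ ↦ AffineMap.lineMap a b t) (Icc 0 1) := by
    refine MDifferentiable.mdifferentiableOn (Differentiable.mdifferentiable ?_)
    exact fun t ↦ AffineMap.hasDerivAt_lineMap.differentiableAt
  exact (S.smooth.mdifferentiableOn (by simp)).comp h fun t ht ↦ S.lineMap_mem ha hb ht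

variable [IsManifold (𝓡 n) ∞ M]

theorem contDiffOn_chartMap
    (hS : S.carrier ⊆ (chartAt (EuclideanSpace ℝ (Fin n)) x₀).source) :
    ContDiffOn ℝ ∞ (S.chartMap x₀) S.simplex.closedInterior :=
  contMDiffOn_iff_contDiffOn.1 <| (contMDiffOn_extChartAt (I := 𝓡 n) (x := x₀)).comp S.smooth
    fun _ hx ↦ hS (S.param_mem_carrier hx)

theorem hasFDerivWithinAt_chartMap
    (hS : S.carrier ⊆ (chartAt (EuclideanSpace ℝ (Fin n)) x₀).source)
    {x : EuclideanSpace ℝ (Fin d)} (hx : x ∈ S.simplex.closedInterior) :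
    HasFDerivWithinAt (S.chartMap x₀) (S.chartDeriv x₀ x) S.simplex.closedInterior x :=
  ((S.contDiffOn_chartMap hS).differentiableOn (by simp) x hx).hasFDerivWithinAt

theorem continuousOn_chartDeriv
    (hS : S.carrier ⊆ (chartAt (EuclideanSpace ℝ (Fin n)) x₀).source) :
    ContinuousOn (S.chartDeriv x₀) S.simplex.closedInterior :=
  (S.contDiffOn_chartMap hS).continuousOn_fderivWithin (uniqueDiffOn_closedInterior _) (by simp)

/-- The tangent trivialization at `x₀` is the differential of the chart. This identity turns the
Riemannian distortion bound into a Euclidean bound on `chartDeriv`. -/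
theorem chartDeriv_apply
    (hS : S.carrier ⊆ (chartAt (EuclideanSpace ℝ (Fin n)) x₀).source)
    {x : EuclideanSpace ℝ (Fin d)} (hx : x ∈ S.simplex.closedInterior)
    (u : EuclideanSpace ℝ (Fin d)) :
    S.chartDeriv x₀ x u = (trivializationAt (EuclideanSpace ℝ (Fin n))
        (TangentSpace (𝓡 n) : M → Type _) x₀).continuousLinearMapAt ℝ (S.param x)
        (S.deriv x u) := by
  have : IsManifold (𝓡 n) 1 M := .of_le (n := ∞) (by norm_num)
  have hsrc := hS (S.param_mem_carrier hx)
  rw [TangentBundle.continuousLinearMapAt_trivializationAt hsrc]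
  have hd := ((S.smooth x hx).mdifferentiableWithinAt (by simp)).hasMFDerivWithinAt
  have := (mdifferentiableAt_extChartAt (I := 𝓡 n) hsrc).hasMFDerivAt.comp_hasMFDerivWithinAt x hd
  have h2 := (uniqueDiffOn_closedInterior S.simplex x hx).eq (S.hasFDerivWithinAt_chartMap hS hx)
    (hasMFDerivWithinAt_iff_hasFDerivWithinAt.1 this)
  exact DFunLike.congr_fun h2 u

theorem hasDerivWithinAt_chartMap_lineMap
    (hS : S.carrier ⊆ (chartAt (EuclideanSpace ℝ (Fin n)) x₀).source)
    {a b : EuclideanSpace ℝ (Fin d)} (ha : a ∈ S.simplex.closedInterior)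
    (hb : b ∈ S.simplex.closedInterior) {t : ℝ} (ht : t ∈ Icc (0 : ℝ) 1) :
    HasDerivWithinAt (fun τ : ℝ ↦ S.chartMap x₀ (AffineMap.lineMap a b τ))
      (S.chartDeriv x₀ (AffineMap.lineMap a b t) (b - a)) (Icc 0 1) t :=
  (S.hasFDerivWithinAt_chartMap hS (S.lineMap_mem ha hb ht)).comp_hasDerivWithinAt t
    AffineMap.hasDerivWithinAt_lineMap fun _ hτ ↦ S.lineMap_mem ha hb hτ

variable {F : Type*} [NormedAddCommGroup F] [NormedSpace ℝ F]

/-- The coefficient of the linear equation of parallel transport along the segment from `a`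
to `b`, in coordinates at `x₀`. -/
def transportCoeff (S : SimplicialRegion n d M) (x₀ : M)
    (Γ : EuclideanSpace ℝ (Fin n) → EuclideanSpace ℝ (Fin n) →L[ℝ] F →L[ℝ] F)
    (a b : EuclideanSpace ℝ (Fin d)) (t : ℝ) : F →L[ℝ] F :=
  Γ (S.chartMap x₀ (AffineMap.lineMap a b t)) (S.chartDeriv x₀ (AffineMap.lineMap a b t) (b - a))

variable {E : M → Type*} [TopologicalSpace (TotalSpace F E)]
  [∀ x, NormedAddCommGroup (E x)] [∀ x, InnerProductSpace ℝ (E x)]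
  [FiberBundle F E] [VectorBundle ℝ F E] [ContMDiffVectorBundle ∞ F E (𝓡 n)]
  {cov : CovariantDerivative (𝓡 n) F E}
  {Γ : EuclideanSpace ℝ (Fin n) → EuclideanSpace ℝ (Fin n) →L[ℝ] F →L[ℝ] F} {W : Set M}

/-- Reduces transport inside `W` to the linear equation in the fixed space `F`. Conversely, a
coordinate solution is lifted to the path by `e.symm`. -/
theorem isTransport_iff (h : IsLocalConnectionForm cov x₀ Γ W) (hS : S.carrier ⊆ W)
    {a b : EuclideanSpace ℝ (Fin d)} (ha : a ∈ S.simplex.closedInterior)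
    (hb : b ∈ S.simplex.closedInterior) (w : E (S.param b)) (w' : E (S.param a)) :
    IsTransport cov (S.path a b) w w' ↔
      IsBackwardValue (S.transportCoeff x₀ Γ a b) (trivializationAt F E x₀ ⟨S.param b, w⟩).2
        (trivializationAt F E x₀ ⟨S.param a, w'⟩).2 := by
  set e := trivializationAt F E x₀ with he
  have h0 : (0 : ℝ) ∈ Icc (0 : ℝ) 1 := ⟨le_rfl, zero_le_one⟩
  have h1 : (1 : ℝ) ∈ Icc (0 : ℝ) 1 := ⟨zero_le_one, le_rfl⟩
  have hpW : ∀ t ∈ Icc (0 : ℝ) 1, S.path a b t ∈ W := fun t ht ↦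
    hS (S.param_mem_carrier (S.lineMap_mem ha hb ht))
  have hcoeff : ∀ V : ℝ → TotalSpace F E, (∀ t ∈ Icc (0 : ℝ) 1, (V t).proj = S.path a b t) →
      (IsParallel cov V ↔ ∀ t ∈ Icc (0 : ℝ) 1, HasDerivWithinAt (fun τ ↦ (e (V τ)).2)
        (-(S.transportCoeff x₀ Γ a b t (e (V t)).2)) (Icc 0 1) t) := by
    intro V hV
    have hVd : MDifferentiableOn 𝓘(ℝ, ℝ) (𝓡 n) (fun τ ↦ (V τ).proj) (Icc 0 1) :=
      (S.mdifferentiableOn_path ha hb).congr hV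
    rw [h.isParallel_iff fun t ht ↦ by rw [hV t ht]; exact hpW t ht, and_iff_right hVd]
    refine forall₂_congr fun t ht ↦ ?_
    have hd := hasDerivWithinAt_extChartAt_comp (x₀ := x₀) (hVd t ht)
      (by rw [hV t ht]; exact h.subset_source (hpW t ht))
    have hd2 := (S.hasDerivWithinAt_chartMap_lineMap (hS.trans h.subset_source) ha hb ht).congr
      (f₁ := fun τ ↦ extChartAt (𝓡 n) x₀ (V τ).proj)
      (fun τ hτ ↦ by rw [hV τ hτ]; rfl) (by rw [hV t ht]; rfl)
    have e1 := (uniqueDiffOn_Icc zero_lt_one t ht).eq_deriv _ hd hd2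
    have e2 : extChartAt (𝓡 n) x₀ (V t).proj = S.chartMap x₀ (AffineMap.lineMap a b t) := by
      rw [hV t ht]; rfl
    rw [e1, e2]
    rfl
  constructor
  · rintro ⟨V, hV, hVp, hV0, hV1⟩
    refine ⟨fun t ↦ (e (V t)).2, (hcoeff V hVp).1 hV, ?_, ?_⟩
    · simp only [hV0]
    · simp only [hV1]
  · rintro ⟨v, hv, hv0, hv1⟩
    have hV : ∀ t ∈ Icc (0 : ℝ) 1,
        (e (⟨S.path a b t, e.symm (S.path a b t) (v t)⟩ : TotalSpace F E)).2 = v t :=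
      fun t ht ↦ by rw [e.apply_mk_symm (h.subset_baseSet (hpW t ht))]
    refine ⟨fun t ↦ ⟨S.path a b t, e.symm (S.path a b t) (v t)⟩, ?_, fun _ _ ↦ rfl, ?_, ?_⟩
    · refine (hcoeff _ fun _ _ ↦ rfl).2 fun t ht ↦ ?_
      rw [hV t ht]
      exact (hv t ht).congr hV (hV t ht)
    · refine totalSpace_eq_of_trivialization e (h.subset_baseSet (hpW 0 h0)) ?_ ?_
      · simp [path]
      · rw [hV 0 h0, hv0]
    · refine totalSpace_eq_of_trivialization e (h.subset_baseSet (hpW 1 h1)) ?_ ?_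
      · simp [path]
      · rw [hV 1 h1, hv1]

end Chart

end SimplicialRegion

/-- A shortcut for instance search. -/
instance instSeminormedAddCommGroupConnectionForm {n : ℕ} {F : Type*} [NormedAddCommGroup F]
    [NormedSpace ℝ F] : SeminormedAddCommGroup (EuclideanSpace ℝ (Fin n) →L[ℝ] F →L[ℝ] F) :=
  ContinuousLinearMap.toSeminormedAddCommGroup

/-- A shortcut for instance search. -/
instance instSeminormedAddGroupConnectionForm {n : ℕ} {F : Type*} [NormedAddCommGroup F]
    [NormedSpace ℝ F] : SeminormedAddGroup (EuclideanSpace ℝ (Fin n) →L[ℝ] F →L[ℝ] F) :=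
  SeminormedAddCommGroup.toSeminormedAddGroup

namespace SimplicialRegion

/-! ### Existence, linearity, continuity and holonomy estimates for transport in a region. -/

section LocalTransport

variable {n d : ℕ} {M : Type*} [TopologicalSpace M] [ChartedSpace (EuclideanSpace ℝ (Fin n)) M]
  {F : Type*} [NormedAddCommGroup F] [NormedSpace ℝ F]
  {Γ : EuclideanSpace ℝ (Fin n) → EuclideanSpace ℝ (Fin n) →L[ℝ] F →L[ℝ] F} {W : Set M}
  {x₀ : M} {B η : ℝ} {S : SimplicialRegion n d M} {a b x y : EuclideanSpace ℝ (Fin d)}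

/-- Here and below `η` bounds the images of differences of points of `σ`, not the operator norm of
`chartDeriv`. This quantity does not change when `σ` is rescaled, and the distortion condition makes
it `O(h)`. -/
theorem norm_transportCoeff_le (hS : S.carrier ⊆ W)
    (hB : ∀ y ∈ W, ‖Γ (extChartAt (𝓡 n) x₀ y)‖ ≤ B)
    (hη : ∀ x ∈ S.simplex.closedInterior, ∀ a ∈ S.simplex.closedInterior,
      ∀ b ∈ S.simplex.closedInterior, ‖S.chartDeriv x₀ x (b - a)‖ ≤ η)
    (ha : a ∈ S.simplex.closedInterior) (hb : b ∈ S.simplex.closedInterior) {t : ℝ}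
    (ht : t ∈ Icc (0 : ℝ) 1) : ‖S.transportCoeff x₀ Γ a b t‖ ≤ B * η := by
  have hm := S.lineMap_mem ha hb ht
  have hB' := hB _ (hS (S.param_mem_carrier hm))
  exact (ContinuousLinearMap.le_opNorm _ _).trans (mul_le_mul hB' (hη _ hm a ha b hb)
    (norm_nonneg _) ((norm_nonneg (Γ _)).trans hB'))

variable {E : M → Type*} [TopologicalSpace (TotalSpace F E)]
  [∀ x, NormedAddCommGroup (E x)] [∀ x, InnerProductSpace ℝ (E x)]
  [FiberBundle F E] {cov : CovariantDerivative (𝓡 n) F E}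

theorem isTransport_R {w : E (S.param b)}
    (h : ∃! w' : E (S.param a), IsTransport cov (S.path a b) w w') :
    IsTransport cov (S.path a b) w (S.R cov a b w) := by
  have h' : ∃ w' : E (S.param a), IsTransport cov (S.path a b) w w' := h.exists
  rw [R, transport, dif_pos h']
  exact h'.choose_spec

variable [IsManifold (𝓡 n) ∞ M]

theorem continuousOn_transportCoeff (hS : S.carrier ⊆ W)
    (hW : W ⊆ (chartAt (EuclideanSpace ℝ (Fin n)) x₀).source)
    (hΓ : ContinuousOn Γ (extChartAt (𝓡 n) x₀ '' W)) (ha : a ∈ S.simplex.closedInterior) :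
    ContinuousOn (fun q : EuclideanSpace ℝ (Fin d) × ℝ ↦ S.transportCoeff x₀ Γ a q.1 q.2)
      (S.simplex.closedInterior ×ˢ Icc 0 1) := by
  have hl : ContinuousOn (fun q : EuclideanSpace ℝ (Fin d) × ℝ ↦ AffineMap.lineMap a q.1 q.2)
      (S.simplex.closedInterior ×ˢ Icc 0 1) := by
    simp only [AffineMap.lineMap_apply_module]
    fun_prop
  have hm : MapsTo (fun q : EuclideanSpace ℝ (Fin d) × ℝ ↦ AffineMap.lineMap a q.1 q.2)
      (S.simplex.closedInterior ×ˢ Icc 0 1) S.simplex.closedInterior :=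
    fun q hq ↦ S.lineMap_mem ha hq.1 hq.2
  refine ContinuousOn.clm_apply ?_ ?_
  · exact hΓ.comp ((S.contDiffOn_chartMap (hS.trans hW)).continuousOn.comp hl hm)
      fun q hq ↦ mem_image_of_mem _ (hS (S.param_mem_carrier (hm hq)))
  · exact ((S.continuousOn_chartDeriv (hS.trans hW)).comp hl hm).clm_apply (by fun_prop)

theorem norm_chartMap_sub_le (hS : S.carrier ⊆ (chartAt (EuclideanSpace ℝ (Fin n)) x₀).source)
    (hη : ∀ x ∈ S.simplex.closedInterior, ∀ a ∈ S.simplex.closedInterior,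
      ∀ b ∈ S.simplex.closedInterior, ‖S.chartDeriv x₀ x (b - a)‖ ≤ η)
    (ha : a ∈ S.simplex.closedInterior) (hb : b ∈ S.simplex.closedInterior) :
    ‖S.chartMap x₀ a - S.chartMap x₀ b‖ ≤ η := by
  simpa using norm_sub_le_of_hasDerivWithinAt_Icc
    (fun t ht ↦ S.hasDerivWithinAt_chartMap_lineMap hS ha hb ht)
    (fun t ht ↦ hη _ (S.lineMap_mem ha hb ht) a ha b hb) ⟨le_rfl, zero_le_one⟩

/-- With `Γ` frozen at `a`, the coefficient has the explicit primitive `Γ_a` of the chart path.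
Freezing costs `Lη · η`, by the Lipschitz bound on `Γ` and the size of the region. The point `a` is
independent of `x` and `y` so that the sides of a triangle can share it. -/
theorem norm_sub_chartMap_le_of_isBackwardValue {L : NNReal} (hS : S.carrier ⊆ W)
    (hW : W ⊆ (chartAt (EuclideanSpace ℝ (Fin n)) x₀).source)
    (hL : LipschitzOnWith L Γ (extChartAt (𝓡 n) x₀ '' W))
    (hB : ∀ y ∈ W, ‖Γ (extChartAt (𝓡 n) x₀ y)‖ ≤ B)
    (hη : ∀ x ∈ S.simplex.closedInterior, ∀ a ∈ S.simplex.closedInterior,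
      ∀ b ∈ S.simplex.closedInterior, ‖S.chartDeriv x₀ x (b - a)‖ ≤ η) (hBη : B * η ≤ 1 / 2)
    (ha : a ∈ S.simplex.closedInterior) (hx : x ∈ S.simplex.closedInterior)
    (hy : y ∈ S.simplex.closedInterior) {w w' : F}
    (h : IsBackwardValue (S.transportCoeff x₀ Γ x y) w w') :
    ‖w' - w - Γ (S.chartMap x₀ a) (S.chartMap x₀ y - S.chartMap x₀ x) w‖ ≤
      (2 * B ^ 2 + L) * η ^ 2 * ‖w‖ := by
  have hΛ : ∀ t ∈ Icc (0 : ℝ) 1, HasDerivWithinAt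
      (fun τ : ℝ ↦ Γ (S.chartMap x₀ a) (S.chartMap x₀ (AffineMap.lineMap x y τ)))
      (Γ (S.chartMap x₀ a) (S.chartDeriv x₀ (AffineMap.lineMap x y t) (y - x))) (Icc 0 1) t :=
    fun t ht ↦ (Γ (S.chartMap x₀ a)).hasFDerivAt.comp_hasDerivWithinAt t
      (S.hasDerivWithinAt_chartMap_lineMap (hS.trans hW) hx hy ht)
  have hη0 : 0 ≤ η := (norm_nonneg _).trans (hη a ha a ha a ha)
  have key := h.norm_sub_primitive_le hBη
    (fun t ht ↦ norm_transportCoeff_le hS hB hη hx hy ht) hΛ (ρ := L * η * η) fun t ht ↦ ?_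
  · rw [← map_sub] at key
    simp only [AffineMap.lineMap_apply_one, AffineMap.lineMap_apply_zero] at key
    refine key.trans (le_of_eq (by ring))
  · have hm := S.lineMap_mem hx hy ht
    rw [transportCoeff, ← sub_apply]
    refine (ContinuousLinearMap.le_opNorm _ _).trans (mul_le_mul ?_ (hη _ hm x hx y hy)
      (norm_nonneg _) (by positivity))
    refine (hL.norm_sub_le (mem_image_of_mem _ (hS (S.param_mem_carrier hm)))
      (mem_image_of_mem _ (hS (S.param_mem_carrier ha)))).trans ?_
    gcongr
    exact norm_chartMap_sub_le (hS.trans hW) hη hm ha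

/-- The three frozen linear terms cancel around the triangle, except that the side from `x` to `a`
acts on `w₁` instead of `w`. This leaves `G(x - a)(w₁ - w)`, which is again of second order. -/
theorem norm_isBackwardValue_triangle_le {L : NNReal} (hS : S.carrier ⊆ W)
    (hW : W ⊆ (chartAt (EuclideanSpace ℝ (Fin n)) x₀).source)
    (hL : LipschitzOnWith L Γ (extChartAt (𝓡 n) x₀ '' W))
    (hB : ∀ y ∈ W, ‖Γ (extChartAt (𝓡 n) x₀ y)‖ ≤ B)
    (hη : ∀ x ∈ S.simplex.closedInterior, ∀ a ∈ S.simplex.closedInterior,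
      ∀ b ∈ S.simplex.closedInterior, ‖S.chartDeriv x₀ x (b - a)‖ ≤ η) (hBη : B * η ≤ 1 / 2)
    (ha : a ∈ S.simplex.closedInterior) (hx : x ∈ S.simplex.closedInterior)
    (hy : y ∈ S.simplex.closedInterior) {w w₁ w₂ w₃ : F}
    (h₁ : IsBackwardValue (S.transportCoeff x₀ Γ x y) w w₁)
    (h₂ : IsBackwardValue (S.transportCoeff x₀ Γ a x) w₁ w₂)
    (h₃ : IsBackwardValue (S.transportCoeff x₀ Γ a y) w w₃) :
    ‖w₂ - w₃‖ ≤ (10 * B ^ 2 + 4 * L) * η ^ 2 * ‖w‖ := by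
  have k₁ := norm_sub_chartMap_le_of_isBackwardValue hS hW hL hB hη hBη ha hx hy h₁
  have k₂ := norm_sub_chartMap_le_of_isBackwardValue hS hW hL hB hη hBη ha ha hx h₂
  have k₃ := norm_sub_chartMap_le_of_isBackwardValue hS hW hL hB hη hBη ha ha hy h₃
  have hη0 : 0 ≤ η := (norm_nonneg _).trans (hη a ha a ha a ha)
  have hBa := hB _ (hS (S.param_mem_carrier ha))
  have hB0 : 0 ≤ B := (norm_nonneg (Γ _)).trans hBa
  have hw₁ := h₁.norm_sub_self_le hBη fun t ht ↦ norm_transportCoeff_le hS hB hη hx hy ht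
  have hw₁' : ‖w₁‖ ≤ 2 * ‖w‖ :=
    h₁.norm_le fun t ht ↦ (norm_transportCoeff_le hS hB hη hx hy ht).trans hBη
  set G := Γ (S.chartMap x₀ a)
  have e : w₂ - w₃ = (w₂ - w₁ - G (S.chartMap x₀ x - S.chartMap x₀ a) w₁) +
      (w₁ - w - G (S.chartMap x₀ y - S.chartMap x₀ x) w) -
      (w₃ - w - G (S.chartMap x₀ y - S.chartMap x₀ a) w) +
      G (S.chartMap x₀ x - S.chartMap x₀ a) (w₁ - w) := by
    simp only [map_sub, sub_apply]
    abel
  have k₄ : ‖G (S.chartMap x₀ x - S.chartMap x₀ a) (w₁ - w)‖ ≤ B * η * (2 * (B * η) * ‖w‖) := by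
    refine (ContinuousLinearMap.le_opNorm _ _).trans (mul_le_mul ?_ hw₁ (norm_nonneg _)
      (by positivity))
    exact (ContinuousLinearMap.le_opNorm _ _).trans (mul_le_mul hBa
      (norm_chartMap_sub_le (hS.trans hW) hη hx ha) (norm_nonneg _) hB0)
  -- The error `2B² + L` is thus counted four times, twice for this side and once for each other;
  -- with the `2B²` of `k₄` the total is `10B² + 4L`.
  have k₂' : (2 * B ^ 2 + L) * η ^ 2 * ‖w₁‖ ≤ (2 * B ^ 2 + L) * η ^ 2 * (2 * ‖w‖) := by gcongr
  rw [e]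
  refine (norm_add_le _ _).trans ((add_le_add_left ((norm_sub_le _ _).trans
    (add_le_add_left (norm_add_le _ _) _)) _).trans ?_)
  refine (add_le_add (add_le_add (add_le_add (k₂.trans k₂') k₁) k₃) k₄).trans (le_of_eq ?_)
  ring

variable [VectorBundle ℝ F E] [ContMDiffVectorBundle ∞ F E (𝓡 n)]

theorem existsUnique_isTransport [CompleteSpace F] (h : IsLocalConnectionForm cov x₀ Γ W)
    (hS : S.carrier ⊆ W) (hΓ : ContinuousOn Γ (extChartAt (𝓡 n) x₀ '' W))
    (hB : ∀ y ∈ W, ‖Γ (extChartAt (𝓡 n) x₀ y)‖ ≤ B)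
    (hη : ∀ x ∈ S.simplex.closedInterior, ∀ a ∈ S.simplex.closedInterior,
      ∀ b ∈ S.simplex.closedInterior, ‖S.chartDeriv x₀ x (b - a)‖ ≤ η) (hBη : B * η ≤ 1 / 2)
    (ha : a ∈ S.simplex.closedInterior) (hb : b ∈ S.simplex.closedInterior) (w : E (S.param b)) :
    ∃! w' : E (S.param a), IsTransport cov (S.path a b) w w' := by
  have hbase := h.subset_baseSet (hS (S.param_mem_carrier ha))
  have hn : ∀ t ∈ Icc (0 : ℝ) 1, ‖S.transportCoeff x₀ Γ a b t‖ ≤ 1 / 2 :=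
    fun t ht ↦ (norm_transportCoeff_le hS hB hη ha hb ht).trans hBη
  have hc : ContinuousOn (S.transportCoeff x₀ Γ a b) (Icc 0 1) :=
    (continuousOn_transportCoeff hS h.subset_source hΓ ha).comp (f := fun t : ℝ ↦ (b, t))
      (by fun_prop) fun t ht ↦ ⟨hb, ht⟩
  obtain ⟨u, hu⟩ := exists_isBackwardValue hc hn (trivializationAt F E x₀ ⟨S.param b, w⟩).2
  refine ⟨(trivializationAt F E x₀).symm (S.param a) u, ?_, fun w' hw' ↦ ?_⟩
  · refine (S.isTransport_iff h hS ha hb _ _).2 ?_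
    rw [Trivialization.apply_mk_symm _ hbase]
    exact hu
  · have := ((S.isTransport_iff h hS ha hb _ _).1 hw').unique hu hn
    rw [← this, Trivialization.symm_apply_apply_mk _ hbase]

theorem isTransport_add (h : IsLocalConnectionForm cov x₀ Γ W) (hS : S.carrier ⊆ W)
    (ha : a ∈ S.simplex.closedInterior) (hb : b ∈ S.simplex.closedInterior)
    {w z : E (S.param b)} {w' z' : E (S.param a)} (hw : IsTransport cov (S.path a b) w w')
    (hz : IsTransport cov (S.path a b) z z') :
    IsTransport cov (S.path a b) (w + z) (w' + z') := by
  rw [S.isTransport_iff h hS ha hb] at hw hz ⊢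
  simp only [trivialization_snd_eq _ (h.subset_baseSet (hS (S.param_mem_carrier ha))),
    trivialization_snd_eq _ (h.subset_baseSet (hS (S.param_mem_carrier hb))), map_add] at hw hz ⊢
  exact hw.add hz

theorem isTransport_smul (h : IsLocalConnectionForm cov x₀ Γ W) (hS : S.carrier ⊆ W)
    (ha : a ∈ S.simplex.closedInterior) (hb : b ∈ S.simplex.closedInterior) (c : ℝ)
    {w : E (S.param b)} {w' : E (S.param a)} (hw : IsTransport cov (S.path a b) w w') :
    IsTransport cov (S.path a b) (c • w) (c • w') := by
  rw [S.isTransport_iff h hS ha hb] at hw ⊢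
  simp only [trivialization_snd_eq _ (h.subset_baseSet (hS (S.param_mem_carrier ha))),
    trivialization_snd_eq _ (h.subset_baseSet (hS (S.param_mem_carrier hb))), map_smul] at hw ⊢
  exact hw.smul c

/-- Sums and multiples of parallel sections are parallel, so uniqueness forces the chosen values to
be linear. This is what allows transport to be moved inside the integral. -/
theorem isLinearMap_R (h : IsLocalConnectionForm cov x₀ Γ W) (hS : S.carrier ⊆ W)
    (ha : a ∈ S.simplex.closedInterior) (hb : b ∈ S.simplex.closedInterior)
    (hR : ∀ w : E (S.param b), ∃! w' : E (S.param a), IsTransport cov (S.path a b) w w') :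
    IsLinearMap ℝ (S.R cov a b) where
  map_add w z := (hR (w + z)).unique (isTransport_R (hR _))
    (isTransport_add h hS ha hb (isTransport_R (hR w)) (isTransport_R (hR z)))
  map_smul c w := (hR (c • w)).unique (isTransport_R (hR _))
    (isTransport_smul h hS ha hb c (isTransport_R (hR w)))

/-- Serves to make the transported density integrable. The coefficient is uniformly continuous on
the compact set `σ × [0,1]`, hence uniformly close for nearby endpoints, and
`IsBackwardValue.norm_sub_le` applies. -/
theorem continuousOn_R (h : IsLocalConnectionForm cov x₀ Γ W) (hS : S.carrier ⊆ W)
    (hΓ : ContinuousOn Γ (extChartAt (𝓡 n) x₀ '' W))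
    (hB : ∀ y ∈ W, ‖Γ (extChartAt (𝓡 n) x₀ y)‖ ≤ B)
    (hη : ∀ x ∈ S.simplex.closedInterior, ∀ a ∈ S.simplex.closedInterior,
      ∀ b ∈ S.simplex.closedInterior, ‖S.chartDeriv x₀ x (b - a)‖ ≤ η) (hBη : B * η ≤ 1 / 2)
    (ha : a ∈ S.simplex.closedInterior)
    (hR : ∀ b ∈ S.simplex.closedInterior, ∀ w : E (S.param b),
      ∃! w' : E (S.param a), IsTransport cov (S.path a b) w w')
    {T : Type*} [TopologicalSpace T] {s : Set T} {q : T → EuclideanSpace ℝ (Fin d)}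
    (hq : ContinuousOn q s) (hqm : MapsTo q s S.simplex.closedInterior)
    {δ : ∀ t, E (S.param (q t))}
    (hδ : ContinuousOn (fun t ↦ (trivializationAt F E x₀ ⟨S.param (q t), δ t⟩).2) s) :
    ContinuousOn (fun t ↦ S.R cov a (q t) (δ t)) s := by
  have hba := h.subset_baseSet (hS (S.param_mem_carrier ha))
  have hn : ∀ b ∈ S.simplex.closedInterior, ∀ t ∈ Icc (0 : ℝ) 1,
      ‖S.transportCoeff x₀ Γ a b t‖ ≤ 1 / 2 :=
    fun b hb t ht ↦ (norm_transportCoeff_le hS hB hη ha hb ht).trans hBη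
  have huc := (S.simplex.isCompact_closedInterior.prod
    (isCompact_Icc (a := (0 : ℝ)) (b := 1))).uniformContinuousOn_of_continuous
    (continuousOn_transportCoeff hS h.subset_source hΓ ha)
  have hval : ∀ t ∈ s, IsBackwardValue (S.transportCoeff x₀ Γ a (q t))
      (trivializationAt F E x₀ ⟨S.param (q t), δ t⟩).2
      (trivializationAt F E x₀ ⟨S.param a, S.R cov a (q t) (δ t)⟩).2 := fun t ht ↦
    (S.isTransport_iff h hS ha (hqm ht) _ _).1 (isTransport_R (hR _ (hqm ht) _))
  suffices hc : ContinuousOn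
      (fun t ↦ (trivializationAt F E x₀ ⟨S.param a, S.R cov a (q t) (δ t)⟩).2) s by
    have := ((trivializationAt F E x₀).symmL ℝ (S.param a)).continuous.comp_continuousOn hc
    refine this.congr fun t _ ↦ ?_
    change _ = (trivializationAt F E x₀).symmL ℝ (S.param a)
      (trivializationAt F E x₀ ⟨S.param a, S.R cov a (q t) (δ t)⟩).2
    rw [trivialization_snd_eq _ hba]
    exact (Trivialization.symmL_continuousLinearMapAt _ hba _).symm
  intro t₀ ht₀
  rw [ContinuousWithinAt, tendsto_iff_norm_sub_tendsto_zero]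
  set z := (trivializationAt F E x₀ ⟨S.param (q t₀), δ t₀⟩).2
  have hlim : Tendsto (fun t ↦ 2 * ‖(trivializationAt F E x₀ ⟨S.param (q t), δ t⟩).2 - z‖)
      (𝓝[s] t₀) (𝓝 0) := by
    simpa using (tendsto_iff_norm_sub_tendsto_zero.1 (hδ t₀ ht₀)).const_mul 2
  rw [Metric.tendsto_nhds]
  intro ε hε
  -- Half of `ε` goes to the variation of the coefficient, the other half to that of the data `δ`.
  -- The `+ 1` in the witness covers `z = 0`.
  obtain ⟨ρ, hρ, hρε⟩ : ∃ ρ > 0, 2 * (ρ * (2 * ‖z‖)) < ε / 2 := by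
    refine ⟨ε / (16 * (‖z‖ + 1)), by positivity, ?_⟩
    have : ε / (16 * (‖z‖ + 1)) * (‖z‖ + 1) = ε / 16 := by field_simp
    nlinarith [norm_nonneg z, show 0 < ε / (16 * (‖z‖ + 1)) by positivity]
  obtain ⟨r, hr, hr'⟩ := Metric.uniformContinuousOn_iff.1 huc ρ hρ
  have hq' : ∀ᶠ t in 𝓝[s] t₀, dist (q t) (q t₀) < r :=
    (hq t₀ ht₀).eventually (Metric.ball_mem_nhds _ hr)
  filter_upwards [hq', hlim.eventually_lt_const (half_pos hε), self_mem_nhdsWithin] with t ht1 ht2 ht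
  have key := (hval t ht).norm_sub_le (hval t₀ ht₀) (hn _ (hqm ht)) (hn _ (hqm ht₀)) (δ := ρ)
    fun τ hτ ↦ by
      rw [← dist_eq_norm]
      refine (hr' (q t, τ) ⟨hqm ht, hτ⟩ (q t₀, τ) ⟨hqm ht₀, hτ⟩ ?_).le
      rw [Prod.dist_eq]
      exact max_lt ht1 (by simpa using hr)
  rw [Real.dist_eq, sub_zero, abs_of_nonneg (norm_nonneg _)]
  linarith

end LocalTransport

end SimplicialRegion

/-! ### Bundle-valued forms in coordinates. -/

namespace BundleForm

variable {n ℓ : ℕ}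
  {M : Type*} [TopologicalSpace M] [ChartedSpace (EuclideanSpace ℝ (Fin n)) M]
  [IsManifold (𝓡 n) ∞ M]
  {F : Type*} [NormedAddCommGroup F] [NormedSpace ℝ F]
  {E : M → Type*} [TopologicalSpace (TotalSpace F E)]
  [∀ x, NormedAddCommGroup (E x)] [∀ x, InnerProductSpace ℝ (E x)]
  [FiberBundle F E]

/-- The coefficients of a bundle-valued form in the trivializations around `x₀`. -/
def localCoeff (F : Type*) [NormedAddCommGroup F] [NormedSpace ℝ F]
    {E : M → Type*} [TopologicalSpace (TotalSpace F E)]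
    [∀ x, NormedAddCommGroup (E x)] [∀ x, InnerProductSpace ℝ (E x)] [FiberBundle F E]
    (α : BundleForm n ℓ E) (x₀ : M) (I : Fin ℓ → Fin n) (y : M) : F :=
  (trivializationAt F E x₀ ⟨y, α y fun k ↦
    (trivializationAt (EuclideanSpace ℝ (Fin n)) (TangentSpace (𝓡 n)) x₀).symmL ℝ y
      (EuclideanSpace.single (I k) 1)⟩).2

variable [VectorBundle ℝ F E]

/-- Multilinear expansion in the coordinate frame. The sum runs over all index maps, not only
increasing ones, so alternation plays no role and later bounds carry the factor `n ^ ℓ`. -/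
theorem trivialization_snd_apply (α : BundleForm n ℓ E) {x₀ y : M}
    (hy : y ∈ (trivializationAt F E x₀).baseSet)
    (hy' : y ∈ (chartAt (EuclideanSpace ℝ (Fin n)) x₀).source)
    (X : Fin ℓ → TangentSpace (𝓡 n) y) :
    (trivializationAt F E x₀ ⟨y, α y X⟩).2 = ∑ I : Fin ℓ → Fin n,
      (∏ k, (trivializationAt (EuclideanSpace ℝ (Fin n)) (TangentSpace (𝓡 n)) x₀
        ).continuousLinearMapAt ℝ y (X k) (I k)) • α.localCoeff F x₀ I y := by
  have hX : X = fun k ↦ ∑ i : Fin n,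
      (trivializationAt (EuclideanSpace ℝ (Fin n)) (TangentSpace (𝓡 n)) x₀
        ).continuousLinearMapAt ℝ y (X k) i •
      (trivializationAt (EuclideanSpace ℝ (Fin n)) (TangentSpace (𝓡 n)) x₀).symmL ℝ y
        (EuclideanSpace.single i 1) := by
    funext k
    simp only [← map_smul, ← map_sum]
    conv_lhs => rw [← Trivialization.symmL_continuousLinearMapAt
      (trivializationAt (EuclideanSpace ℝ (Fin n)) (TangentSpace (𝓡 n)) x₀) (R := ℝ)
      (by simpa using hy') (X k)]
    congr 1
    have := (EuclideanSpace.basisFun (Fin n) ℝ).sum_repr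
      ((trivializationAt (EuclideanSpace ℝ (Fin n)) (TangentSpace (𝓡 n)) x₀
        ).continuousLinearMapAt ℝ y (X k))
    simpa using this.symm
  rw [trivialization_snd_eq _ hy]
  conv_lhs => rw [hX]
  have := (α y).toMultilinearMap.map_sum (fun k i ↦
      (trivializationAt (EuclideanSpace ℝ (Fin n)) (TangentSpace (𝓡 n)) x₀
        ).continuousLinearMapAt ℝ y (X k) i •
      (trivializationAt (EuclideanSpace ℝ (Fin n)) (TangentSpace (𝓡 n)) x₀).symmL ℝ y
        (EuclideanSpace.single i 1))
  refine (congrArg _ this).trans ?_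
  rw [map_sum]
  refine Finset.sum_congr rfl fun I _ ↦ ?_
  rw [MultilinearMap.map_smul_univ, map_smul, localCoeff, trivialization_snd_eq _ hy]
  rfl

variable [ContMDiffVectorBundle ∞ F E (𝓡 n)]

/-- The coefficients are values of `α` on coordinate vector fields, which are smooth on the common
domain of the chart and the trivialization. -/
theorem IsSmooth.continuousOn_localCoeff {α : BundleForm n ℓ E} (hα : α.IsSmooth F) (x₀ : M)
    (I : Fin ℓ → Fin n) : ContinuousOn (α.localCoeff F x₀ I)
      ((trivializationAt F E x₀).baseSet ∩ (chartAt (EuclideanSpace ℝ (Fin n)) x₀).source) := by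
  have ho : IsOpen ((trivializationAt F E x₀).baseSet ∩
      (chartAt (EuclideanSpace ℝ (Fin n)) x₀).source) :=
    (trivializationAt F E x₀).open_baseSet.inter (chartAt _ x₀).open_source
  have key := hα _ ho (fun k y ↦
    (trivializationAt (EuclideanSpace ℝ (Fin n)) (TangentSpace (𝓡 n)) x₀).symmL ℝ y
      (EuclideanSpace.single (I k) 1)) fun k ↦ by
    refine ((trivializationAt (EuclideanSpace ℝ (Fin n)) (TangentSpace (𝓡 n)) x₀
      ).contMDiffOn_section_iff (IB := 𝓡 n) ho ?_).2 ?_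
    · exact fun y hy ↦ by simpa using hy.2
    · refine (contMDiffOn_const (c := EuclideanSpace.single (I k) (1 : ℝ))).congr fun y hy ↦ ?_
      have hy' : y ∈ (trivializationAt (EuclideanSpace ℝ (Fin n))
        (TangentSpace (𝓡 n)) x₀).baseSet := by simpa using hy.2
      rw [trivialization_snd_eq _ hy', Trivialization.continuousLinearMapAt_symmL _ hy']
  exact (((trivializationAt F E x₀).contMDiffOn_section_iff (IB := 𝓡 n) ho
    inter_subset_left).1 key).continuousOn

end BundleForm

namespace SimplicialRegion

/-! ### The difference of centers as an integral of discrete curvatures. -/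

section CenterDifference

variable {n d ℓ : ℕ} {M : Type*} [TopologicalSpace M] [ChartedSpace (EuclideanSpace ℝ (Fin n)) M]
  {F : Type*} [NormedAddCommGroup F] [NormedSpace ℝ F]
  {E : M → Type*} [TopologicalSpace (TotalSpace F E)]
  [∀ x, NormedAddCommGroup (E x)] [∀ x, InnerProductSpace ℝ (E x)]
  [FiberBundle F E]
  {S : SimplicialRegion n d M} {cov : CovariantDerivative (𝓡 n) F E} {α : BundleForm n ℓ E}
  {τ : Affine.Simplex ℝ (EuclideanSpace ℝ (Fin d)) ℓ}

/-- Transport to `v₀` is linear on a finite-dimensional fiber, hence continuous, and commutes with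
the integral. The difference is then estimated pointwise on `m`. -/
theorem norm_centerDifference_le [∀ x, FiniteDimensional ℝ (E x)]
    (hτ : τ.closedInterior ⊆ S.simplex.closedInterior)
    (hlin : ∀ x ∈ S.simplex.closedInterior, ∀ y ∈ S.simplex.closedInterior,
      IsLinearMap ℝ (S.R cov x y))
    (hint : ∀ c ∈ S.simplex.closedInterior,
      IntegrableOn (S.transportedDensity cov α τ c) (unitSimplex ℓ))
    (hmass : IntegrableOn (fun t ↦ ‖S.density α τ t‖) (unitSimplex ℓ)) {κ : ℝ}
    (hκ : ∀ x ∈ S.simplex.closedInterior, ∀ y ∈ S.simplex.closedInterior, ∀ w : E (S.param y),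
      ‖S.discreteCurvature cov (S.simplex.points 0) x y w‖ ≤ κ * ‖w‖) :
    ‖S.centerDifference cov α τ‖ ≤ 2 * κ * S.massIntegral α τ := by
  have h0 := S.simplex.point_mem_closedInterior 0
  have : ∀ x, CompleteSpace (E x) := fun x ↦ FiniteDimensional.complete ℝ (E x)
  have key : ∀ c ∈ S.simplex.closedInterior,
      IntegrableOn (fun t ↦ S.R cov (S.simplex.points 0) c (S.transportedDensity cov α τ c t))
        (unitSimplex ℓ) ∧
      S.R cov (S.simplex.points 0) c (S.connIntegral cov α τ c) =
      ∫ t in unitSimplex ℓ, S.R cov (S.simplex.points 0) c (S.transportedDensity cov α τ c t) := by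
    intro c hc
    let T := LinearMap.toContinuousLinearMap ((hlin _ h0 c hc).mk' _)
    exact ⟨T.integrable_comp (hint c hc), (T.integral_comp_comm (hint c hc)).symm⟩
  have hm := hτ (centroid_mem_closedInterior τ)
  have hs := centroid_mem_closedInterior S.simplex
  rw [centerDifference, (key _ hm).2, (key _ hs).2, ← integral_sub (key _ hm).1 (key _ hs).1,
    massIntegral, ← integral_const_mul]
  refine norm_integral_le_of_norm_le (hmass.const_mul _)
    (ae_restrict_of_forall_mem (isCompact_unitSimplex ℓ).measurableSet fun t ht ↦ ?_)
  have hp := hτ (simplexPoint_mem_closedInterior τ ht)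
  -- The direct transport from `p` to `v₀` is subtracted from both terms and cancels. Each center
  -- contributes one discrete curvature, whence the factor 2.
  have e : S.R cov (S.simplex.points 0) τ.centroid (S.transportedDensity cov α τ τ.centroid t) -
      S.R cov (S.simplex.points 0) S.simplex.centroid
        (S.transportedDensity cov α τ S.simplex.centroid t) =
      S.discreteCurvature cov (S.simplex.points 0) τ.centroid (simplexPoint τ t)
        (S.density α τ t) -
      S.discreteCurvature cov (S.simplex.points 0) S.simplex.centroid (simplexPoint τ t)
        (S.density α τ t) := by
    simp only [discreteCurvature, transportedDensity]
    abel
  rw [e]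
  refine (norm_sub_le _ _).trans ((add_le_add (hκ _ hm _ hp _) (hκ _ hs _ hp _)).trans
    (le_of_eq (by ring)))

end CenterDifference

/-! ### Curvature and density bounds in the fiber norms. -/

section LocalBounds

variable {n d ℓ : ℕ} {M : Type*} [TopologicalSpace M] [ChartedSpace (EuclideanSpace ℝ (Fin n)) M]
  [IsManifold (𝓡 n) ∞ M]
  {F : Type*} [NormedAddCommGroup F] [NormedSpace ℝ F]
  {E : M → Type*} [TopologicalSpace (TotalSpace F E)]
  [∀ x, NormedAddCommGroup (E x)] [∀ x, InnerProductSpace ℝ (E x)]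
  [FiberBundle F E] [VectorBundle ℝ F E]
  {S : SimplicialRegion n d M} {cov : CovariantDerivative (𝓡 n) F E} {α : BundleForm n ℓ E}
  {Γ : EuclideanSpace ℝ (Fin n) → EuclideanSpace ℝ (Fin n) →L[ℝ] F →L[ℝ] F} {W : Set M}
  {x₀ : M} {B D η : ℝ} {a x y : EuclideanSpace ℝ (Fin d)}
  {τ : Affine.Simplex ℝ (EuclideanSpace ℝ (Fin d)) ℓ}

theorem norm_fiber_le (hW : W ⊆ (trivializationAt F E x₀).baseSet)
    (hD : ∀ y ∈ W, ∀ u : F, ‖(trivializationAt F E x₀).symmL ℝ y u‖ ≤ D * ‖u‖)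
    {p : M} (hp : p ∈ W) (w : E p) :
    ‖w‖ ≤ D * ‖(trivializationAt F E x₀ ⟨p, w⟩).2‖ := by
  have := hD p hp (trivializationAt F E x₀ ⟨p, w⟩).2
  rwa [trivialization_snd_eq _ (hW hp), Trivialization.symmL_continuousLinearMapAt _ (hW hp),
    ← trivialization_snd_eq _ (hW hp)] at this

theorem norm_discreteCurvature_le {D' : ℝ} {L : NNReal}
    [ContMDiffVectorBundle ∞ F E (𝓡 n)] (h : IsLocalConnectionForm cov x₀ Γ W)
    (hS : S.carrier ⊆ W)
    (hL : LipschitzOnWith L Γ (extChartAt (𝓡 n) x₀ '' W))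
    (hB : ∀ y ∈ W, ‖Γ (extChartAt (𝓡 n) x₀ y)‖ ≤ B)
    (hη : ∀ x ∈ S.simplex.closedInterior, ∀ a ∈ S.simplex.closedInterior,
      ∀ b ∈ S.simplex.closedInterior, ‖S.chartDeriv x₀ x (b - a)‖ ≤ η) (hBη : B * η ≤ 1 / 2)
    (hD0 : 0 ≤ D)
    (hD : ∀ y ∈ W, ∀ u : F, ‖(trivializationAt F E x₀).symmL ℝ y u‖ ≤ D * ‖u‖)
    (hD' : ∀ y ∈ W, ∀ w : E y, ‖(trivializationAt F E x₀ ⟨y, w⟩).2‖ ≤ D' * ‖w‖)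
    (hR : ∀ a ∈ S.simplex.closedInterior, ∀ b ∈ S.simplex.closedInterior, ∀ w : E (S.param b),
      ∃! w' : E (S.param a), IsTransport cov (S.path a b) w w')
    (ha : a ∈ S.simplex.closedInterior) (hx : x ∈ S.simplex.closedInterior)
    (hy : y ∈ S.simplex.closedInterior) (w : E (S.param y)) :
    ‖S.discreteCurvature cov a x y w‖ ≤
      D * D' * (10 * B ^ 2 + 4 * L) * η ^ 2 * ‖w‖ := by
  have hpa := hS (S.param_mem_carrier ha)
  have key := norm_isBackwardValue_triangle_le hS h.subset_source hL hB hη hBη ha hx hy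
    ((S.isTransport_iff h hS hx hy _ _).1 (isTransport_R (hR x hx y hy w)))
    ((S.isTransport_iff h hS ha hx _ _).1 (isTransport_R (hR a ha x hx _)))
    ((S.isTransport_iff h hS ha hy _ _).1 (isTransport_R (hR a ha y hy w)))
  refine (norm_fiber_le h.subset_baseSet hD hpa _).trans ?_
  have hw := hD' _ (hS (S.param_mem_carrier hy)) w
  rw [discreteCurvature, trivialization_snd_eq _ (h.subset_baseSet hpa), map_sub,
    ← trivialization_snd_eq _ (h.subset_baseSet hpa),
    ← trivialization_snd_eq _ (h.subset_baseSet hpa)]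
  calc _ ≤ D * ((10 * B ^ 2 + 4 * L) * η ^ 2 * (D' * ‖w‖)) := by gcongr; exact key.trans (by gcongr)
    _ = _ := by ring

/-- Each of the `ℓ` edge vectors is a difference of two points of `σ`, so its chart image
contributes one factor `η`. There are `n ^ ℓ` index maps. -/
theorem norm_density_le {B' : ℝ} (hS : S.carrier ⊆ W)
    (hW : W ⊆ (trivializationAt F E x₀).baseSet)
    (hW' : W ⊆ (chartAt (EuclideanSpace ℝ (Fin n)) x₀).source)
    (hη : ∀ x ∈ S.simplex.closedInterior, ∀ a ∈ S.simplex.closedInterior,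
      ∀ b ∈ S.simplex.closedInterior, ‖S.chartDeriv x₀ x (b - a)‖ ≤ η) (hD0 : 0 ≤ D)
    (hD : ∀ y ∈ W, ∀ u : F, ‖(trivializationAt F E x₀).symmL ℝ y u‖ ≤ D * ‖u‖)
    (hB' : ∀ I, ∀ y ∈ W, ‖α.localCoeff F x₀ I y‖ ≤ B')
    (hτ : τ.closedInterior ⊆ S.simplex.closedInterior) {t : Fin ℓ → ℝ} (ht : t ∈ unitSimplex ℓ) :
    ‖S.density α τ t‖ ≤ D * ((n : ℝ) ^ ℓ * B') * η ^ ℓ := by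
  have hp := hτ (simplexPoint_mem_closedInterior τ ht)
  have hpW := hS (S.param_mem_carrier hp)
  have hη0 : 0 ≤ η := (norm_nonneg _).trans (hη _ hp _ hp _ hp)
  refine (norm_fiber_le hW hD hpW _).trans ?_
  rw [density, BundleForm.trivialization_snd_apply _ (hW hpW) (hW' hpW)]
  have : ∀ I ∈ (Finset.univ : Finset (Fin ℓ → Fin n)),
      ‖(∏ k, (trivializationAt (EuclideanSpace ℝ (Fin n)) (TangentSpace (𝓡 n)) x₀
        ).continuousLinearMapAt ℝ (S.param (simplexPoint τ t))
          (S.deriv (simplexPoint τ t) (τ.points k.succ - τ.points 0)) (I k)) •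
        α.localCoeff F x₀ I (S.param (simplexPoint τ t))‖ ≤ η ^ ℓ * B' := by
    intro I _
    rw [norm_smul, norm_prod]
    refine mul_le_mul ?_ (hB' I _ hpW) (norm_nonneg _) (by positivity)
    refine (Finset.prod_le_prod (fun _ _ ↦ norm_nonneg _) (g := fun _ ↦ η) fun k _ ↦ ?_).trans
      (by simp)
    rw [← S.chartDeriv_apply (hS.trans hW') hp]
    exact (PiLp.norm_apply_le _ _).trans (hη _ hp _ (hτ (τ.point_mem_closedInterior 0)) _
      (hτ (τ.point_mem_closedInterior k.succ)))
  calc _ ≤ D * ∑ I : Fin ℓ → Fin n, η ^ ℓ * B' := by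
        gcongr; exact norm_sum_le_of_le _ this
    _ = _ := by simp; ring

theorem continuousOn_density_snd (hS : S.carrier ⊆ W)
    (hW : W ⊆ (trivializationAt F E x₀).baseSet)
    (hW' : W ⊆ (chartAt (EuclideanSpace ℝ (Fin n)) x₀).source)
    (hc : ∀ I, ContinuousOn (α.localCoeff F x₀ I) W)
    (hτ : τ.closedInterior ⊆ S.simplex.closedInterior) :
    ContinuousOn (fun t ↦ (trivializationAt F E x₀
      ⟨S.param (simplexPoint τ t), S.density α τ t⟩).2) (unitSimplex ℓ) := by
  have hm : MapsTo (simplexPoint τ) (unitSimplex ℓ) S.simplex.closedInterior :=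
    fun t ht ↦ hτ (simplexPoint_mem_closedInterior τ ht)
  have hq := (continuous_simplexPoint τ).continuousOn (s := unitSimplex ℓ)
  have hd := (S.continuousOn_chartDeriv (hS.trans hW')).comp hq hm
  have : ContinuousOn (fun t ↦ ∑ I : Fin ℓ → Fin n,
      (∏ k, S.chartDeriv x₀ (simplexPoint τ t) (τ.points k.succ - τ.points 0) (I k)) •
        α.localCoeff F x₀ I (S.param (simplexPoint τ t))) (unitSimplex ℓ) := by
    refine continuousOn_finsetSum _ fun I _ ↦ ContinuousOn.smul
      (continuousOn_finsetProd _ fun k _ ↦ ?_)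
      ((hc I).comp (S.smooth.continuousOn.comp hq hm) fun t ht ↦
        hS (S.param_mem_carrier (hm ht)))
    exact (EuclideanSpace.proj (𝕜 := ℝ) (I k)).continuous.comp_continuousOn
      (hd.clm_apply continuousOn_const)
  refine this.congr fun t ht ↦ ?_
  have hpW := hS (S.param_mem_carrier (hm ht))
  simp only [density, BundleForm.trivialization_snd_apply _ (hW hpW) (hW' hpW),
    S.chartDeriv_apply (hS.trans hW') (hm ht)]

/-- The norm changes with the fiber. The density is therefore viewed as a continuous map into the
total space, and the continuous fiber metric is evaluated on it. -/
theorem continuousOn_norm_density [IsContinuousRiemannianBundle F E] (hS : S.carrier ⊆ W)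
    (hW : W ⊆ (trivializationAt F E x₀).baseSet)
    (hW' : W ⊆ (chartAt (EuclideanSpace ℝ (Fin n)) x₀).source)
    (hc : ∀ I, ContinuousOn (α.localCoeff F x₀ I) W)
    (hτ : τ.closedInterior ⊆ S.simplex.closedInterior) :
    ContinuousOn (fun t ↦ ‖S.density α τ t‖) (unitSimplex ℓ) := by
  have hm : MapsTo (simplexPoint τ) (unitSimplex ℓ) S.simplex.closedInterior :=
    fun t ht ↦ hτ (simplexPoint_mem_closedInterior τ ht)
  have hbase := fun t ht ↦ hW (hS (S.param_mem_carrier (hm (x := t) ht)))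
  have hq : ContinuousOn (fun t ↦ S.param (simplexPoint τ t)) (unitSimplex ℓ) :=
    S.smooth.continuousOn.comp (continuous_simplexPoint τ).continuousOn hm
  have key : ContinuousOn (fun t ↦ TotalSpace.mk' F (S.param (simplexPoint τ t))
      (S.density α τ t)) (unitSimplex ℓ) := by
    refine ((trivializationAt F E x₀).continuousOn_symm.comp
      (hq.prodMk (continuousOn_density_snd hS hW hW' hc hτ))
      fun t ht ↦ ⟨hbase t ht, mem_univ _⟩).congr fun t ht ↦ ?_
    change _ = TotalSpace.mk' F (S.param (simplexPoint τ t))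
      ((trivializationAt F E x₀).symm (S.param (simplexPoint τ t))
        (trivializationAt F E x₀ ⟨S.param (simplexPoint τ t), S.density α τ t⟩).2)
    rw [Trivialization.symm_apply_apply_mk _ (hbase t ht)]
  refine (key.inner_bundle key).sqrt.congr fun t _ ↦ ?_
  simp only [real_inner_self_eq_norm_sq, Real.sqrt_sq (norm_nonneg _)]

end LocalBounds

end SimplicialRegion

theorem finiteDimensional_fiber {B : Type*} [TopologicalSpace B] (F : Type*)
    [NormedAddCommGroup F] [NormedSpace ℝ F] [FiniteDimensional ℝ F] (E : B → Type*)
    [TopologicalSpace (TotalSpace F E)]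
    [∀ x, NormedAddCommGroup (E x)] [∀ x, NormedSpace ℝ (E x)] [FiberBundle F E]
    [VectorBundle ℝ F E] (x : B) : FiniteDimensional ℝ (E x) :=
  ((trivializationAt F E x).continuousLinearEquivAt ℝ x
    (mem_baseSet_trivializationAt F E x)).symm.toLinearEquiv.finiteDimensional

/-! ### Uniform bounds, near a point and then on a compact set. -/

namespace SimplicialRegion

variable {n ℓ : ℕ}
  {M : Type*} [EMetricSpace M] [ChartedSpace (EuclideanSpace ℝ (Fin n)) M]
  {F : Type*} [NormedAddCommGroup F] [NormedSpace ℝ F]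
  {E : M → Type*} [TopologicalSpace (TotalSpace F E)]
  [∀ x, NormedAddCommGroup (E x)] [∀ x, InnerProductSpace ℝ (E x)]
  [FiberBundle F E]

theorem diam_nonneg (S : SimplicialRegion n ℓ M) : 0 ≤ S.diam := ENNReal.toReal_nonneg

/-- Uniform bounds, with constant `A`, for the parallel transports on a region and for the
integrals of a form over its subcells at the first vertex. -/
structure TransportBounds (S : SimplicialRegion n (ℓ + 1) M)
    (cov : CovariantDerivative (𝓡 n) F E) (α : BundleForm n ℓ E) (A : ℝ) : Prop where
  existsUnique : ∀ x ∈ S.simplex.closedInterior, ∀ y ∈ S.simplex.closedInterior,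
    ∀ w : E (S.param y), ∃! w' : E (S.param x), IsTransport cov (S.path x y) w w'
  isLinearMap : ∀ x ∈ S.simplex.closedInterior, ∀ y ∈ S.simplex.closedInterior,
    IsLinearMap ℝ (S.R cov x y)
  curvature_le : ∀ x ∈ S.simplex.closedInterior, ∀ y ∈ S.simplex.closedInterior,
    ∀ w : E (S.param y),
      ‖S.discreteCurvature cov (S.simplex.points 0) x y w‖ ≤ A * S.diam ^ 2 * ‖w‖
  integrableOn : ∀ (fs : Finset (Fin (ℓ + 1 + 1))) (hfs : fs.card = ℓ + 1),
    ∀ c ∈ S.simplex.closedInterior,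
      IntegrableOn (S.transportedDensity cov α (S.simplex.face hfs) c) (unitSimplex ℓ)
  difference_le_mass : ∀ (fs : Finset (Fin (ℓ + 1 + 1))) (hfs : fs.card = ℓ + 1) (κ : ℝ),
    (∀ x ∈ S.simplex.closedInterior, ∀ y ∈ S.simplex.closedInterior, ∀ w : E (S.param y),
      ‖S.discreteCurvature cov (S.simplex.points 0) x y w‖ ≤ κ * ‖w‖) →
    ‖S.centerDifference cov α (S.simplex.face hfs)‖ ≤
      2 * κ * S.massIntegral α (S.simplex.face hfs)
  mass_le : ∀ (fs : Finset (Fin (ℓ + 1 + 1))) (hfs : fs.card = ℓ + 1),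
    S.massIntegral α (S.simplex.face hfs) ≤ A * S.diam ^ ℓ
  difference_le : ∀ (fs : Finset (Fin (ℓ + 1 + 1))) (hfs : fs.card = ℓ + 1),
    ‖S.centerDifference cov α (S.simplex.face hfs)‖ ≤ A * S.diam ^ (ℓ + 2)

theorem TransportBounds.mono {S : SimplicialRegion n (ℓ + 1) M}
    {cov : CovariantDerivative (𝓡 n) F E} {α : BundleForm n ℓ E} {A A' : ℝ}
    (h : S.TransportBounds cov α A) (hA : A ≤ A') : S.TransportBounds cov α A' where
  existsUnique := h.existsUnique
  isLinearMap := h.isLinearMap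
  curvature_le x hx y hy w := (h.curvature_le x hx y hy w).trans (by gcongr)
  integrableOn := h.integrableOn
  difference_le_mass := h.difference_le_mass
  mass_le fs hfs := (h.mass_le fs hfs).trans (by have := S.diam_nonneg; gcongr)
  difference_le fs hfs := (h.difference_le fs hfs).trans (by have := S.diam_nonneg; gcongr)

variable [RiemannianBundle (fun x : M ↦ TangentSpace (𝓡 n) x)]

/-- If the diameter were zero, the distortion bound would make the differential vanish, against the
immersion property. As `toReal` sends `⊤` to `0`, this also rules out an infinite diameter. -/
theorem diam_pos {S : SimplicialRegion n (ℓ + 1) M} {C : ℝ} (hC : S.DistortionLE C) :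
    0 < S.diam := by
  refine S.diam_nonneg.lt_of_ne fun h0 ↦ ?_
  have hd := diam_closedInterior_pos S.simplex
  have hx := S.simplex.point_mem_closedInterior 0
  have h := hC _ hx (EuclideanSpace.single 0 1)
  rw [← h0, mul_zero, zero_mul] at h
  have h1 : S.deriv (S.simplex.points 0) (EuclideanSpace.single 0 1) = 0 := by
    rw [← norm_le_zero_iff]
    exact le_of_mul_le_mul_left (by simpa using h) hd
  have : (EuclideanSpace.single 0 1 : EuclideanSpace ℝ (Fin (ℓ + 1))) = 0 :=
    S.immersion _ hx (h1.trans (map_zero _).symm)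
  simp at this

theorem carrier_subset_eball {S : SimplicialRegion n (ℓ + 1) M} {C : ℝ} (hC : S.DistortionLE C)
    {δ : ENNReal} (hδ : ENNReal.ofReal S.diam < δ) {p : M} (hp : p ∈ S.carrier) :
    S.carrier ⊆ Metric.eball p δ := by
  have hfin : Metric.ediam S.carrier ≠ ⊤ := fun h ↦ by
    have := diam_pos hC
    simp [SimplicialRegion.diam, h] at this
  intro q hq
  rw [Metric.mem_eball]
  refine (Metric.edist_le_ediam_of_mem hq hp).trans_lt ?_
  rwa [SimplicialRegion.diam, ENNReal.ofReal_toReal hfin] at hδ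

variable [IsManifold (𝓡 n) ∞ M]

theorem norm_chartDeriv_le {S : SimplicialRegion n (ℓ + 1) M} {C D : ℝ} {W : Set M} {x₀ : M}
    (hC : S.DistortionLE C) (hS : S.carrier ⊆ W)
    (hW : W ⊆ (chartAt (EuclideanSpace ℝ (Fin n)) x₀).source) (hD0 : 0 ≤ D)
    (hD : ∀ y ∈ W, ∀ v : TangentSpace (𝓡 n) y,
      ‖(trivializationAt (EuclideanSpace ℝ (Fin n)) (TangentSpace (𝓡 n)) x₀
        ).continuousLinearMapAt ℝ y v‖ ≤ D * ‖v‖)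
    {x a b : EuclideanSpace ℝ (Fin (ℓ + 1))} (hx : x ∈ S.simplex.closedInterior)
    (ha : a ∈ S.simplex.closedInterior) (hb : b ∈ S.simplex.closedInterior) :
    ‖S.chartDeriv x₀ x (b - a)‖ ≤ D * |C| * S.diam := by
  have hd := diam_closedInterior_pos S.simplex
  -- Since `‖b - a‖ ≤ diam σ`, the factor `diam σ` in the distortion condition cancels. The absolute
  -- value allows for an arbitrary real `C`.
  have h1 : ‖S.deriv x (b - a)‖ ≤ |C| * S.diam := by
    refine le_of_mul_le_mul_left ?_ hd
    refine (hC x hx _).trans ?_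
    have hab : ‖b - a‖ ≤ Metric.diam S.simplex.closedInterior := by
      rw [← dist_eq_norm]
      exact Metric.dist_le_diam_of_mem S.simplex.isCompact_closedInterior.isBounded hb ha
    have := S.diam_nonneg
    calc C * S.diam * ‖b - a‖ ≤ |C| * S.diam * Metric.diam S.simplex.closedInterior := by
          gcongr; exact le_abs_self C
      _ = _ := by ring
  rw [S.chartDeriv_apply (hS.trans hW) hx, mul_assoc]
  exact (hD _ (hS (S.param_mem_carrier hx)) _).trans (by gcongr)

variable [IsContMDiffRiemannianBundle (𝓡 n) ∞ (EuclideanSpace ℝ (Fin n))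
    (fun x : M ↦ TangentSpace (𝓡 n) x)]
  [FiniteDimensional ℝ F] [VectorBundle ℝ F E] [ContMDiffVectorBundle ∞ F E (𝓡 n)]
  [IsContinuousRiemannianBundle F E]

theorem exists_nhds_transportBounds (cov : CovariantDerivative (𝓡 n) F E)
    (hcov : cov.ContMDiffCovariantDerivative ∞) {α : BundleForm n ℓ E} (hα : α.IsSmooth F)
    (C : ℝ) (x₀ : M) : ∃ W ∈ 𝓝 x₀, ∃ A h₀ : ℝ, 0 < h₀ ∧
      ∀ S : SimplicialRegion n (ℓ + 1) M, S.carrier ⊆ W → S.DistortionLE C → S.diam ≤ h₀ →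
        S.TransportBounds cov α A := by
  have : IsManifold (𝓡 n) 1 M := .of_le (n := ∞) (by norm_num)
  have : IsContinuousRiemannianBundle (EuclideanSpace ℝ (Fin n))
      (fun x : M ↦ TangentSpace (𝓡 n) x) := by
    obtain ⟨g, hg, hg'⟩ := IsContMDiffRiemannianBundle.exists_contMDiff (IB := 𝓡 n) (n := ∞)
      (F := EuclideanSpace ℝ (Fin n)) (E := fun x : M ↦ TangentSpace (𝓡 n) x)
    exact ⟨g, hg.continuous, hg'⟩
  have : CompleteSpace F := FiniteDimensional.complete ℝ F
  have : ∀ x, FiniteDimensional ℝ (E x) := finiteDimensional_fiber F E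
  obtain ⟨Γ, W₁, hW₁, h₁, ⟨L, hL⟩, B, hB⟩ := exists_isLocalConnectionForm cov hcov x₀
  obtain ⟨T, hT0, hT⟩ := eventually_norm_trivializationAt_lt (EuclideanSpace ℝ (Fin n))
    (fun x : M ↦ TangentSpace (𝓡 n) x) x₀
  obtain ⟨D', hD'0, hD'⟩ := eventually_norm_trivializationAt_lt F E x₀
  obtain ⟨D, hD0, hD⟩ := eventually_norm_symmL_trivializationAt_lt F E x₀
  have hU : (trivializationAt F E x₀).baseSet ∩
      (chartAt (EuclideanSpace ℝ (Fin n)) x₀).source ∈ 𝓝 x₀ :=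
    inter_mem ((trivializationAt F E x₀).open_baseSet.mem_nhds
      (mem_baseSet_trivializationAt F E x₀)) (chart_source_mem_nhds _ x₀)
  have hco := fun I ↦ hα.continuousOn_localCoeff x₀ I
  -- A sum over the finitely many index maps gives one bound for all coefficients.
  let B' : ℝ := ∑ I, (‖α.localCoeff F x₀ I x₀‖ + 1)
  have hB' : ∀ᶠ y in 𝓝 x₀, ∀ I, ‖α.localCoeff F x₀ I y‖ ≤ B' := by
    refine eventually_all.2 fun I ↦ ?_
    have hle : ‖α.localCoeff F x₀ I x₀‖ + 1 ≤ B' :=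
      Finset.single_le_sum (f := fun I ↦ ‖α.localCoeff F x₀ I x₀‖ + 1)
        (fun _ _ ↦ by positivity) (Finset.mem_univ I)
    filter_upwards [((hco I).continuousAt hU).norm.eventually_lt_const (lt_add_one _)] with y hy
    exact hy.le.trans hle
  have hB'0 : 0 ≤ B' := Finset.sum_nonneg fun _ _ ↦ by positivity
  let W := W₁ ∩ {y | (‖(trivializationAt (EuclideanSpace ℝ (Fin n))
      (fun x : M ↦ TangentSpace (𝓡 n) x) x₀).continuousLinearMapAt ℝ y‖ < T) ∧
    ‖(trivializationAt F E x₀).continuousLinearMapAt ℝ y‖ < D' ∧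
    ‖(trivializationAt F E x₀).symmL ℝ y‖ < D ∧ ∀ I, ‖α.localCoeff F x₀ I y‖ ≤ B'}
  have hW : W ∈ 𝓝 x₀ := inter_mem hW₁ (hT.and (hD'.and (hD.and hB')))
  have h : IsLocalConnectionForm cov x₀ Γ W :=
    ⟨inter_subset_left.trans h₁.subset_baseSet, inter_subset_left.trans h₁.subset_source,
      fun y hy ↦ h₁.cov_eq y hy.1⟩
  have hLW : LipschitzOnWith L Γ (extChartAt (𝓡 n) x₀ '' W) :=
    hL.mono (image_mono inter_subset_left)
  have hBW : ∀ y ∈ W, ‖Γ (extChartAt (𝓡 n) x₀ y)‖ ≤ B := fun y hy ↦ hB y hy.1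
  have hB0 : 0 ≤ B := (norm_nonneg (Γ _)).trans (hB x₀ (mem_of_mem_nhds hW₁))
  -- The chart bound is `η = G h`, where `T` bounds the tangent trivialization. Then `A₁` is the
  -- curvature constant and `A₂` the mass constant, including the volume of the parameter simplex.
  let G := T * |C|
  have hG : 0 ≤ G := by positivity
  let A₁ := D * D' * (10 * B ^ 2 + 4 * L) * G ^ 2
  let A₂ := D * ((n : ℝ) ^ ℓ * B') * G ^ ℓ * volume.real (unitSimplex ℓ)
  have hA₁ : 0 ≤ A₁ := by positivity
  -- The threshold on `h` ensures `B η = B G h ≤ 1/2`, as the linear equation estimates require; the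
  -- `+ 1` keeps the denominator positive when `B G = 0`. One constant serves curvature, mass and
  -- their product.
  refine ⟨W, hW, max A₁ (max A₂ (2 * A₁ * A₂)), 1 / (2 * (B * G + 1)), by positivity,
    fun S hS hC hh ↦ ?_⟩
  have hη : ∀ x ∈ S.simplex.closedInterior, ∀ a ∈ S.simplex.closedInterior,
      ∀ b ∈ S.simplex.closedInterior, ‖S.chartDeriv x₀ x (b - a)‖ ≤ G * S.diam :=
    fun x hx a ha b hb ↦ norm_chartDeriv_le hC hS h.subset_source hT0.le
      (fun y hy v ↦ (ContinuousLinearMap.le_of_opNorm_le _ hy.2.1.le v)) hx ha hb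
  have hd := S.diam_nonneg
  have hBη : B * (G * S.diam) ≤ 1 / 2 := by
    calc B * (G * S.diam) = B * G * S.diam := by ring
      _ ≤ (B * G + 1) * (1 / (2 * (B * G + 1))) := by gcongr; linarith
      _ = 1 / 2 := by field_simp
  have hDW : ∀ y ∈ W, ∀ u : F, ‖(trivializationAt F E x₀).symmL ℝ y u‖ ≤ D * ‖u‖ :=
    fun y hy u ↦ ContinuousLinearMap.le_of_opNorm_le _ hy.2.2.2.1.le u
  have hDW' : ∀ y ∈ W, ∀ w : E y, ‖(trivializationAt F E x₀ ⟨y, w⟩).2‖ ≤ D' * ‖w‖ :=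
    fun y hy w ↦ by
      rw [trivialization_snd_eq _ (h.subset_baseSet hy)]
      exact ContinuousLinearMap.le_of_opNorm_le _ hy.2.2.1.le w
  have hcW : ∀ I, ContinuousOn (α.localCoeff F x₀ I) W := fun I ↦
    (hco I).mono fun y hy ↦ ⟨h.subset_baseSet hy, h.subset_source hy⟩
  have hf : ∀ (fs : Finset (Fin (ℓ + 1 + 1))) (hfs : fs.card = ℓ + 1),
      (S.simplex.face hfs).closedInterior ⊆ S.simplex.closedInterior :=
    fun fs hfs ↦ S.simplex.closedInterior_face_subset_closedInterior hfs
  have hR : ∀ a ∈ S.simplex.closedInterior, ∀ b ∈ S.simplex.closedInterior, ∀ w : E (S.param b),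
      ∃! w' : E (S.param a), IsTransport cov (S.path a b) w w' := fun a ha b hb w ↦
    existsUnique_isTransport h hS hLW.continuousOn hBW hη hBη ha hb w
  have hlin : ∀ x ∈ S.simplex.closedInterior, ∀ y ∈ S.simplex.closedInterior,
      IsLinearMap ℝ (S.R cov x y) := fun x hx y hy ↦
    isLinearMap_R h hS hx hy (hR x hx y hy)
  have hcurv : ∀ x ∈ S.simplex.closedInterior, ∀ y ∈ S.simplex.closedInterior,
      ∀ w : E (S.param y),
      ‖S.discreteCurvature cov (S.simplex.points 0) x y w‖ ≤ A₁ * S.diam ^ 2 * ‖w‖ :=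
    fun x hx y hy w ↦ (norm_discreteCurvature_le h hS hLW hBW hη hBη hD0.le hDW hDW' hR
      (S.simplex.point_mem_closedInterior 0) hx hy w).trans (le_of_eq (by simp only [A₁]; ring))
  have hint : ∀ (fs : Finset (Fin (ℓ + 1 + 1))) (hfs : fs.card = ℓ + 1),
      ∀ c ∈ S.simplex.closedInterior,
      IntegrableOn (S.transportedDensity cov α (S.simplex.face hfs) c) (unitSimplex ℓ) :=
    fun fs hfs c hc ↦ (continuousOn_R h hS hLW.continuousOn hBW hη hBη hc (hR c hc)
      (continuous_simplexPoint _).continuousOn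
      (fun t ht ↦ hf fs hfs (simplexPoint_mem_closedInterior _ ht))
      (continuousOn_density_snd hS h.subset_baseSet h.subset_source hcW (hf fs hfs))
      ).integrableOn_compact (isCompact_unitSimplex ℓ)
  have hmass : ∀ (fs : Finset (Fin (ℓ + 1 + 1))) (hfs : fs.card = ℓ + 1),
      S.massIntegral α (S.simplex.face hfs) ≤ A₂ * S.diam ^ ℓ := fun fs hfs ↦ by
    rw [massIntegral]
    refine (Real.le_norm_self _).trans ((norm_setIntegral_le_of_norm_le_const
      (C := D * ((n : ℝ) ^ ℓ * B') * (G * S.diam) ^ ℓ)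
      (isCompact_unitSimplex ℓ).measure_lt_top fun t ht ↦ ?_).trans (le_of_eq ?_))
    · rw [norm_norm]
      exact norm_density_le hS h.subset_baseSet h.subset_source hη hD0.le hDW
        (fun I y hy ↦ hy.2.2.2.2 I) (hf fs hfs) ht
    · simp only [A₂]; ring
  have hdiff : ∀ (fs : Finset (Fin (ℓ + 1 + 1))) (hfs : fs.card = ℓ + 1) (κ : ℝ),
      (∀ x ∈ S.simplex.closedInterior, ∀ y ∈ S.simplex.closedInterior, ∀ w : E (S.param y),
        ‖S.discreteCurvature cov (S.simplex.points 0) x y w‖ ≤ κ * ‖w‖) →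
      ‖S.centerDifference cov α (S.simplex.face hfs)‖ ≤
        2 * κ * S.massIntegral α (S.simplex.face hfs) := fun fs hfs κ hκ ↦
    norm_centerDifference_le (hf fs hfs) hlin (hint fs hfs)
      ((continuousOn_norm_density hS h.subset_baseSet h.subset_source hcW
        (hf fs hfs)).integrableOn_compact (isCompact_unitSimplex ℓ)) hκ
  refine ⟨hR, hlin, fun x hx y hy w ↦ (hcurv x hx y hy w).trans ?_, hint, hdiff,
    fun fs hfs ↦ (hmass fs hfs).trans ?_, fun fs hfs ↦ (hdiff fs hfs _ hcurv).trans ?_⟩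
  · gcongr; exact le_max_left _ _
  · gcongr; exact (le_max_left _ _).trans (le_max_right _ _)
  · calc _ ≤ 2 * (A₁ * S.diam ^ 2) * (A₂ * S.diam ^ ℓ) := by gcongr; exact hmass fs hfs
      _ = 2 * A₁ * A₂ * S.diam ^ (ℓ + 2) := by ring
      _ ≤ _ := by gcongr; exact (le_max_right _ _).trans (le_max_right _ _)

/-- A region with diameter below a Lebesgue number of the cover lies in the ball about its first
vertex, hence in one of finitely many good neighborhoods. -/
theorem exists_transportBounds (cov : CovariantDerivative (𝓡 n) F E)
    (hcov : cov.ContMDiffCovariantDerivative ∞) {α : BundleForm n ℓ E} (hα : α.IsSmooth F)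
    {K : Set M} (hK : IsCompact K) (C : ℝ) : ∃ A h₀ : ℝ, 0 < h₀ ∧
      ∀ S : SimplicialRegion n (ℓ + 1) M, S.carrier ⊆ K → S.DistortionLE C → S.diam ≤ h₀ →
        S.TransportBounds cov α A := by
  choose W hW A h₀ hh₀ hA using exists_nhds_transportBounds cov hcov hα C
  obtain ⟨t, ht, hKt⟩ := hK.elim_nhds_subcover (fun x ↦ interior (W x))
    fun x _ ↦ interior_mem_nhds.2 (hW x)
  obtain ⟨δ, hδ, hδK⟩ := lebesgue_number_lemma_of_emetric
    (c := fun x : t ↦ interior (W x)) hK (fun _ ↦ isOpen_interior) (by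
      refine hKt.trans (iUnion₂_subset fun x hx ↦ ?_)
      exact subset_iUnion (fun x : t ↦ interior (W x)) ⟨x, hx⟩)
  obtain ⟨ρ, hρ, hρδ⟩ : ∃ ρ : ℝ, 0 < ρ ∧ ENNReal.ofReal ρ < δ := by
    obtain ⟨ρ, hρ, hρδ⟩ := ENNReal.lt_iff_exists_nnreal_btwn.1 hδ
    exact ⟨ρ, by simpa using hρ, by simpa using hρδ⟩
  -- The subcover is empty when `K` is, so the minimum of the thresholds needs a default value.
  obtain ⟨h₁, hh₁, hle⟩ : ∃ h₁ : ℝ, 0 < h₁ ∧ ∀ x ∈ t, h₁ ≤ h₀ x := by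
    rcases t.eq_empty_or_nonempty with rfl | hne
    · exact ⟨1, one_pos, by simp⟩
    · exact ⟨t.inf' hne h₀, (Finset.lt_inf'_iff _).2 fun x _ ↦ hh₀ x,
        fun x hx ↦ Finset.inf'_le _ hx⟩
  refine ⟨∑ x ∈ t, |A x|, min ρ h₁, lt_min hρ hh₁, fun S hS hC hd ↦ ?_⟩
  have hp := S.param_mem_carrier (S.simplex.point_mem_closedInterior 0)
  obtain ⟨⟨x, hx⟩, hxW⟩ := hδK _ (hS hp)
  have hSW : S.carrier ⊆ W x := (carrier_subset_eball hC
    ((ENNReal.ofReal_le_ofReal (hd.trans (min_le_left _ _))).trans_lt hρδ) hp).trans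
      (hxW.trans interior_subset)
  exact (hA x S hSW hC ((hd.trans (min_le_right _ _)).trans (hle x hx))).mono
    ((le_abs_self _).trans (Finset.single_le_sum (f := fun x ↦ |A x|)
      (fun _ _ ↦ abs_nonneg _) hx))

end SimplicialRegion

/-! ### The estimate in a local frame. -/

section Frame

variable {n r : ℕ}
  {M : Type*} [TopologicalSpace M] [ChartedSpace (EuclideanSpace ℝ (Fin n)) M]
  {F : Type*} [NormedAddCommGroup F] [NormedSpace ℝ F]
  {E : M → Type*} [TopologicalSpace (TotalSpace F E)]
  [∀ x, NormedAddCommGroup (E x)] [∀ x, InnerProductSpace ℝ (E x)]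
  [FiberBundle F E] {f : Fin r → ∀ x : M, E x} {U : Set M}

theorem sum_coeff_smul (hf : IsLocalFrameOn (𝓡 n) F ∞ f U) {x : M} (hx : x ∈ U) (w : E x) :
    ∑ i, hf.coeff i x w • f i x = w := by
  simpa [IsLocalFrameOn.coeff, hx] using (hf.toBasisAt hx).sum_repr w

/-- Linear independence at `x₀` makes the combination map `T` of the frame vectors bounded below. By
continuity of the frame, its combination map at a nearby `y` is a small perturbation of `T`, and the
error is absorbed. -/
theorem exists_nhds_coeff_le [VectorBundle ℝ F E] [IsContinuousRiemannianBundle F E]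
    (hU : IsOpen U) (hf : IsLocalFrameOn (𝓡 n) F ∞ f U) {x₀ : M} (hx₀ : x₀ ∈ U) :
    ∃ V ∈ 𝓝 x₀, ∃ B, ∀ y ∈ V, ∀ w : E y, ∀ i, |hf.coeff i y w| ≤ B * ‖w‖ := by
  set e := trivializationAt F E x₀
  obtain ⟨D, hD0, hD⟩ := eventually_norm_trivializationAt_lt F E x₀
  let u : Fin r → M → F := fun i y ↦ (e ⟨y, f i y⟩).2
  have hb := mem_baseSet_trivializationAt F E x₀
  have hu : ∀ i, ContinuousAt (u i) x₀ := fun i ↦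
    (FiberBundle.continuousAt_totalSpace F _).1 (hf.contMDiffAt hU hx₀ i).continuousAt |>.2
  let T : (Fin r → ℝ) →ₗ[ℝ] F := Fintype.linearCombination ℝ (fun i ↦ u i x₀)
  have hT : LinearMap.ker T = ⊥ := by
    have : LinearIndependent ℝ fun i ↦ u i x₀ := by
      have h2 := (hf.linearIndependent hx₀).map' (e.linearEquivAt ℝ x₀ hb).toLinearMap
        (LinearEquiv.ker _)
      exact h2
    exact LinearMap.ker_eq_bot.2 (linearIndependent_iff_injective_fintypeLinearCombination.1 this)
  obtain ⟨m, hm0, hm⟩ := T.exists_antilipschitzWith hT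
  -- With this threshold the perturbation costs at most `‖c‖ / 2` after multiplication by the
  -- antilipschitz constant `m`.
  have hnear : ∀ᶠ y in 𝓝 x₀, ∑ i, ‖u i y - u i x₀‖ < 1 / (2 * m) := by
    have : ContinuousAt (fun y ↦ ∑ i, ‖u i y - u i x₀‖) x₀ :=
      tendsto_finsetSum _ fun i _ ↦ ((hu i).sub continuousAt_const).norm
    exact this.eventually_lt_const (by simpa using hm0)
  refine ⟨_, (hnear.and (hD.and ((hU.eventually_mem hx₀).and
    (e.open_baseSet.eventually_mem hb)))), 2 * m * D, ?_⟩
  rintro y ⟨hy, hyD, hyU, hyb⟩ w i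
  set c : Fin r → ℝ := fun i ↦ hf.coeff i y w
  have hm0' : (0 : ℝ) < m := hm0
  have h1 : ‖c‖ ≤ m * ‖T c‖ := by simpa using hm.le_mul_dist c 0
  have h2 : ∑ i, c i • u i y = (e ⟨y, w⟩).2 := by
    conv_rhs => rw [trivialization_snd_eq _ hyb, ← sum_coeff_smul hf hyU w, map_sum]
    simp only [map_smul, u, trivialization_snd_eq _ hyb, c]
  have h3 : T c = (e ⟨y, w⟩).2 - ∑ i, c i • (u i y - u i x₀) := by
    simp only [← h2, T, Fintype.linearCombination_apply, smul_sub, Finset.sum_sub_distrib]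
    abel
  have h4 : ‖∑ i, c i • (u i y - u i x₀)‖ ≤ ‖c‖ * (1 / (2 * m)) := by
    refine (norm_sum_le_of_le _ (f := fun i ↦ c i • (u i y - u i x₀))
      (n := fun i ↦ ‖c‖ * ‖u i y - u i x₀‖) fun i _ ↦ ?_).trans ?_
    · rw [norm_smul]; gcongr; exact norm_le_pi_norm c i
    · rw [← Finset.mul_sum]; gcongr
  have h5 : ‖(e ⟨y, w⟩).2‖ ≤ D * ‖w‖ := by
    rw [trivialization_snd_eq _ hyb]
    exact ContinuousLinearMap.le_of_opNorm_le _ hyD.le w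
  have h6 : ‖c‖ ≤ m * (D * ‖w‖) + ‖c‖ / 2 := by
    calc ‖c‖ ≤ m * (D * ‖w‖ + ‖c‖ * (1 / (2 * m))) := by
          refine h1.trans ?_
          gcongr
          rw [h3]
          exact (norm_sub_le _ _).trans (add_le_add h5 h4)
      _ = _ := by field_simp
  have h7 : |c i| ≤ ‖c‖ := norm_le_pi_norm c i
  refine h7.trans ?_
  linarith

theorem exists_coeff_le [VectorBundle ℝ F E] [IsContinuousRiemannianBundle F E]
    (hU : IsOpen U) (hf : IsLocalFrameOn (𝓡 n) F ∞ f U) {K : Set M} (hK : IsCompact K)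
    (hKU : K ⊆ U) : ∃ B, 0 ≤ B ∧ ∀ y ∈ K, ∀ w : E y, ∀ i, |hf.coeff i y w| ≤ B * ‖w‖ := by
  refine hK.induction_on (p := fun s ↦ ∃ B, 0 ≤ B ∧ ∀ y ∈ s, ∀ w : E y, ∀ i,
    |hf.coeff i y w| ≤ B * ‖w‖) ⟨0, le_rfl, by simp⟩ ?_ ?_ fun x hx ↦ ?_
  · rintro s t hst ⟨B, hB0, hB⟩
    exact ⟨B, hB0, fun y hy ↦ hB y (hst hy)⟩
  · rintro s t ⟨B, hB0, hB⟩ ⟨B', _, hB'⟩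
    refine ⟨max B B', hB0.trans (le_max_left _ _), ?_⟩
    rintro y (hy | hy) w i
    · exact (hB y hy w i).trans (by gcongr; exact le_max_left _ _)
    · exact (hB' y hy w i).trans (by gcongr; exact le_max_right _ _)
  · obtain ⟨V, hV, B, hB⟩ := exists_nhds_coeff_le hU hf (hKU hx)
    exact ⟨V, mem_nhdsWithin_of_mem_nhds hV, |B|, abs_nonneg _, fun y hy w i ↦
      (hB y hy w i).trans (by gcongr; exact le_abs_self B)⟩

namespace SimplicialRegion

variable {d ℓ : ℕ} {S : SimplicialRegion n d M} {cov : CovariantDerivative (𝓡 n) F E}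
  {α : BundleForm n ℓ E} {τ : Affine.Simplex ℝ (EuclideanSpace ℝ (Fin d)) ℓ}

theorem frameMatrix_mulVec (hf : IsLocalFrameOn (𝓡 n) F ∞ f U)
    {a b : EuclideanSpace ℝ (Fin d)} (hb : S.param b ∈ U) (hlin : IsLinearMap ℝ (S.R cov a b))
    (w : E (S.param b)) :
    (S.frameMatrix cov hf a b).mulVec (fun i ↦ hf.coeff i (S.param b) w) =
      fun i ↦ hf.coeff i (S.param a) (S.R cov a b w) := by
  funext i
  conv_rhs => rw [← sum_coeff_smul hf hb w, ← hlin.mk'_apply, map_sum, map_sum]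
  simp only [Matrix.mulVec, dotProduct, frameMatrix, Matrix.of_apply, map_smul,
    IsLinearMap.mk'_apply, smul_eq_mul, mul_comm]

/-- The frame at `p` drops out of the matrix product, so the frame density is the image of the
transported density under one fixed linear map on `E_c`. Such a map commutes with the integral. -/
theorem integrableOn_ppfDensity [∀ x, FiniteDimensional ℝ (E x)]
    (hf : IsLocalFrameOn (𝓡 n) F ∞ f U) (hU : S.carrier ⊆ U)
    (hτ : τ.closedInterior ⊆ S.simplex.closedInterior)
    {c : EuclideanSpace ℝ (Fin d)}
    (hlin : ∀ y ∈ S.simplex.closedInterior, IsLinearMap ℝ (S.R cov c y))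
    (hint : IntegrableOn (S.transportedDensity cov α τ c) (unitSimplex ℓ)) :
    IntegrableOn (S.ppfDensity cov hf α τ c) (unitSimplex ℓ) ∧
      ∫ t in unitSimplex ℓ, S.ppfDensity cov hf α τ c t =
        fun i ↦ hf.coeff i (S.param c) (S.connIntegral cov α τ c) := by
  have : ∀ x, CompleteSpace (E x) := fun x ↦ FiniteDimensional.complete ℝ (E x)
  let Φ : E (S.param c) →L[ℝ] (Fin r → ℝ) :=
    LinearMap.toContinuousLinearMap (LinearMap.pi fun i ↦ hf.coeff i (S.param c))
  have he : EqOn (fun t ↦ Φ (S.transportedDensity cov α τ c t)) (S.ppfDensity cov hf α τ c)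
      (unitSimplex ℓ) := fun t ht ↦ by
    have hp := hτ (simplexPoint_mem_closedInterior τ ht)
    exact (frameMatrix_mulVec hf (hU (S.param_mem_carrier hp)) (hlin _ hp) _).symm
  have hms := (isCompact_unitSimplex ℓ).measurableSet
  refine ⟨IntegrableOn.congr_fun (Φ.integrable_comp hint) he hms, ?_⟩
  rw [← setIntegral_congr_fun hms he]
  exact Φ.integral_comp_comm hint

/-- Reduces the frame estimate to the intrinsic one: the intermediate frames at the centers cancel
and only the frame at `v₀` remains. -/
theorem frameCenterDifference_eq [∀ x, FiniteDimensional ℝ (E x)]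
    (hf : IsLocalFrameOn (𝓡 n) F ∞ f U) (hU : S.carrier ⊆ U)
    (hτ : τ.closedInterior ⊆ S.simplex.closedInterior)
    (hlin : ∀ x ∈ S.simplex.closedInterior, ∀ y ∈ S.simplex.closedInterior,
      IsLinearMap ℝ (S.R cov x y))
    (hint : ∀ c ∈ S.simplex.closedInterior,
      IntegrableOn (S.transportedDensity cov α τ c) (unitSimplex ℓ)) :
    S.frameCenterDifference cov hf α τ =
      fun i ↦ hf.coeff i (S.param (S.simplex.points 0)) (S.centerDifference cov α τ) := by
  have hm := hτ (centroid_mem_closedInterior τ)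
  have hs := centroid_mem_closedInterior S.simplex
  have h0 := S.simplex.point_mem_closedInterior 0
  rw [frameCenterDifference, (integrableOn_ppfDensity hf hU hτ (hlin _ hm) (hint _ hm)).2,
    (integrableOn_ppfDensity hf hU hτ (hlin _ hs) (hint _ hs)).2,
    frameMatrix_mulVec hf (hU (S.param_mem_carrier hm)) (hlin _ h0 _ hm),
    frameMatrix_mulVec hf (hU (S.param_mem_carrier hs)) (hlin _ h0 _ hs)]
  funext i
  rw [Pi.sub_apply, centerDifference, map_sub]

end SimplicialRegion

end Frame

end PPF

end

theorem mainTheorem5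
    {n ℓ : ℕ}
    -- a Riemannian manifold `M`
    {M : Type*} [EMetricSpace M] [ChartedSpace (EuclideanSpace ℝ (Fin n)) M]
    [IsManifold (𝓡 n) ∞ M]
    [RiemannianBundle (fun x : M ↦ TangentSpace (𝓡 n) x)]
    [IsContMDiffRiemannianBundle (𝓡 n) ∞ (EuclideanSpace ℝ (Fin n))
      (fun x : M ↦ TangentSpace (𝓡 n) x)]
    [IsRiemannianManifold (𝓡 n) M]
    -- a smooth vector bundle `E` of finite rank over `M`, with a continuous fiber metric
    {F : Type*} [NormedAddCommGroup F] [NormedSpace ℝ F] [FiniteDimensional ℝ F]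
    {E : M → Type*} [TopologicalSpace (TotalSpace F E)]
    [∀ x, NormedAddCommGroup (E x)] [∀ x, InnerProductSpace ℝ (E x)]
    [FiberBundle F E] [VectorBundle ℝ F E] [ContMDiffVectorBundle ∞ F E (𝓡 n)]
    [IsContinuousRiemannianBundle F E]
    -- a smooth connection, and a smooth `E`-valued `ℓ`-form
    (cov : CovariantDerivative (𝓡 n) F E) (hcov : cov.ContMDiffCovariantDerivative ∞)
    (α : PPF.BundleForm n ℓ E) (hα : α.IsSmooth F) :
    -- the intrinsic estimate
    (∀ (K : Set M) (C : ℝ), IsCompact K → ∃ A h₀ : ℝ, 0 < h₀ ∧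
      ∀ S : PPF.SimplicialRegion n (ℓ + 1) M,
        S.carrier ⊆ K → S.DistortionLE C → S.diam ≤ h₀ →
        -- the parallel transports exist and are unique
        (∀ x ∈ S.simplex.closedInterior, ∀ y ∈ S.simplex.closedInterior,
          ∀ w : E (S.param y), ∃! w' : E (S.param x),
            PPF.IsTransport cov (S.path x y) w w') ∧
        -- the discrete curvature is of order `h²`
        (∀ x ∈ S.simplex.closedInterior, ∀ y ∈ S.simplex.closedInterior,
          ∀ w : E (S.param y),
            ‖S.discreteCurvature cov (S.simplex.points 0) x y w‖ ≤ A * S.diam ^ 2 * ‖w‖) ∧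
        -- for every subcell `m` with `ℓ + 1` vertices, one of which is `v₀`
        ∀ (fs : Finset (Fin (ℓ + 1 + 1))) (hfs : fs.card = ℓ + 1), 0 ∈ fs →
          -- both integrals exist
          IntegrableOn (S.transportedDensity cov α (S.simplex.face hfs)
            (S.simplex.face hfs).centroid) (PPF.unitSimplex ℓ) ∧
          IntegrableOn (S.transportedDensity cov α (S.simplex.face hfs)
            S.simplex.centroid) (PPF.unitSimplex ℓ) ∧
          -- their difference is controlled by discrete curvature times an integral over `m`
          (∀ κ : ℝ,
            (∀ x ∈ S.simplex.closedInterior, ∀ y ∈ S.simplex.closedInterior,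
              ∀ w : E (S.param y),
                ‖S.discreteCurvature cov (S.simplex.points 0) x y w‖ ≤ κ * ‖w‖) →
            ‖S.centerDifference cov α (S.simplex.face hfs)‖ ≤
              2 * κ * S.massIntegral α (S.simplex.face hfs)) ∧
          S.massIntegral α (S.simplex.face hfs) ≤ A * S.diam ^ ℓ ∧
          -- hence is of order `h^(ℓ+2)`
          ‖S.centerDifference cov α (S.simplex.face hfs)‖ ≤ A * S.diam ^ (ℓ + 2)) ∧
    -- the estimate in a local frame
    (∀ (r : ℕ) (f : Fin r → ∀ x : M, E x) (U : Set M), IsOpen U →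
      ∀ hf : IsLocalFrameOn (𝓡 n) F ∞ f U,
      ∀ (K : Set M) (C : ℝ), IsCompact K → K ⊆ U → ∃ A h₀ : ℝ, 0 < h₀ ∧
      ∀ S : PPF.SimplicialRegion n (ℓ + 1) M,
        S.carrier ⊆ K → S.DistortionLE C → S.diam ≤ h₀ →
        ∀ (fs : Finset (Fin (ℓ + 1 + 1))) (hfs : fs.card = ℓ + 1), 0 ∈ fs →
          IntegrableOn (S.ppfDensity cov hf α (S.simplex.face hfs)
            (S.simplex.face hfs).centroid) (PPF.unitSimplex ℓ) ∧
          IntegrableOn (S.ppfDensity cov hf α (S.simplex.face hfs)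
            S.simplex.centroid) (PPF.unitSimplex ℓ) ∧
          ‖S.frameCenterDifference cov hf α (S.simplex.face hfs)‖ ≤
            A * S.diam ^ (ℓ + 2)) := by 
  have hfin : ∀ x, FiniteDimensional ℝ (E x) := PPF.finiteDimensional_fiber F E
  refine ⟨fun K C hK ↦ ?_, fun r f U hU hf K C hK hKU ↦ ?_⟩
  · obtain ⟨A, h₀, hh₀, hA⟩ := PPF.SimplicialRegion.exists_transportBounds cov hcov hα hK C
    refine ⟨A, h₀, hh₀, fun S hS hC hd ↦ ?_⟩
    have h := hA S hS hC hd
    refine ⟨h.existsUnique, h.curvature_le, fun fs hfs _ ↦ ⟨h.integrableOn fs hfs _ ?_,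
      h.integrableOn fs hfs _ (PPF.centroid_mem_closedInterior _), h.difference_le_mass fs hfs,
      h.mass_le fs hfs, h.difference_le fs hfs⟩⟩
    exact S.simplex.closedInterior_face_subset_closedInterior hfs
      (PPF.centroid_mem_closedInterior _)
  · obtain ⟨A, h₀, hh₀, hA⟩ := PPF.SimplicialRegion.exists_transportBounds cov hcov hα hK C
    obtain ⟨B, hB0, hB⟩ := PPF.exists_coeff_le hU hf hK hKU
    -- `A` is the intrinsic constant and `B` bounds each frame coefficient at `v₀`. The norm on `Fin
    -- r → ℝ` is the sup norm, so no factor depending on `r` appears.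
    refine ⟨B * A, h₀, hh₀, fun S hS hC hd fs hfs _ ↦ ?_⟩
    have h := hA S hS hC hd
    have hτ := S.simplex.closedInterior_face_subset_closedInterior hfs
    have hm := hτ (PPF.centroid_mem_closedInterior _)
    have hs := PPF.centroid_mem_closedInterior S.simplex
    have hint := h.integrableOn fs hfs
    have hv := hS (S.param_mem_carrier (S.simplex.point_mem_closedInterior 0))
    have hle := h.difference_le fs hfs
    refine ⟨(PPF.SimplicialRegion.integrableOn_ppfDensity hf (hS.trans hKU) hτ
        (h.isLinearMap _ hm) (hint _ hm)).1,
      (PPF.SimplicialRegion.integrableOn_ppfDensity hf (hS.trans hKU) hτ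
        (h.isLinearMap _ hs) (hint _ hs)).1, ?_⟩
    rw [PPF.SimplicialRegion.frameCenterDifference_eq hf (hS.trans hKU) hτ h.isLinearMap hint,
      mul_assoc]
    refine (pi_norm_le_iff_of_nonneg (mul_nonneg hB0 ((norm_nonneg _).trans hle))).2 fun i ↦ ?_
    exact (hB _ hv _ i).trans (mul_le_mul_of_nonneg_left hle hB0)
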